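/- Here a graph is a finite multigraph (finitely many vertices and edges; multiple edges are allowed), regarded as a topological space, namely the compact one-dimensional CW complex with one $0$-cell for each vertex and one $1$-cell for each edge. For a continuous function $f : X \to \mathbb{R}$ on a topological space, write $x \sim y$ if $f(x) = f(y)$ and $x, y$ lie on the same connected component of $f^{-1}(f(x))$; the Reeb space of $f$ is $W_f = X/{\sim}$ with the quotient topology, and $q_f : X \to W_f$ is the quotient map. Let $m \ge 2$ and let $G$ be a graph without loops. Then there exist a closed (i.e. compact without boundary, not necessarily connected) smooth $m$-dimensional manifold $M$ and a $C^\infty$ function $f : M \to \mathbb{R}$ with only finitely many critical values such that $G$ is the Reeb space of $f$: there is a homeomorphism $G \to W_f$ that maps the set of vertices of $G$ exactly onto the set of those points $q_f(x)$ with $x$ a critical point of $f$. -/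

import Mathlib

open scoped Manifold ContDiff

/-! ### Reeb spaces -/

section Reeb

variable {X Y : Type*} [TopologicalSpace X]

/-- Two points are equivalent when they have the same value and lie on the same connected
component of their common level set. -/
def reebSetoid (f : X → Y) : Setoid X where
  r x y := f x = f y ∧ y ∈ connectedComponentIn (f ⁻¹' {f x}) x
  iseqv :=
    { refl := fun x => ⟨rfl, mem_connectedComponentIn (by simp)⟩
      symm := by
        rintro x y ⟨h, hy⟩
        refine ⟨h.symm, ?_⟩
        rw [← h, ← connectedComponentIn_eq hy]
        exact mem_connectedComponentIn (by simp)
      trans := by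
        rintro x y z ⟨h, hy⟩ ⟨h', hz⟩
        refine ⟨h.trans h', ?_⟩
        rw [← h, ← connectedComponentIn_eq hy] at hz
        exact hz }

/-- The Reeb space `W_f`: the space of connected components of level sets. -/
def ReebSpace (f : X → Y) : Type _ := Quotient (reebSetoid f)

/-- The Reeb space carries the quotient topology. -/
instance ReebSpace.instTopologicalSpace (f : X → Y) : TopologicalSpace (ReebSpace f) :=
  inferInstanceAs (TopologicalSpace (Quotient (reebSetoid f)))

/-- The quotient map `q_f : X → W_f`. -/
def reebProj (f : X → Y) (x : X) : ReebSpace f := Quotient.mk (reebSetoid f) x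

end Reeb

/-! ### Critical points -/

/-- The critical points of a real-valued function on a smooth `m`-manifold without boundary:
the points where the differential vanishes. (Only used for smooth functions.) -/
def criticalPoints (m : ℕ) {M : Type*} [TopologicalSpace M]
    [ChartedSpace (EuclideanSpace ℝ (Fin m)) M] (f : M → ℝ) : Set M :=
  {x | mfderiv (𝓡 m) 𝓘(ℝ, ℝ) f x = 0}

/-! ### The topological space of a multigraph -/

namespace Graph

variable {α β : Type*} (G : Graph α β)

theorem exists_isLink_edge (e : E(G)) : ∃ p : V(G) × V(G), G.IsLink e.1 p.1.1 p.2.1 := by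
  obtain ⟨x, y, h⟩ := G.exists_isLink_of_mem_edgeSet e.2
  exact ⟨(⟨x, h.left_mem⟩, ⟨y, h.right_mem⟩), h⟩

/-- The two ends of each edge, in an arbitrarily chosen order. -/
noncomputable def edgeEnds (e : E(G)) : V(G) × V(G) := (G.exists_isLink_edge e).choose

theorem isLink_edgeEnds (e : E(G)) :
    G.IsLink e.1 (G.edgeEnds e).1.1 (G.edgeEnds e).2.1 := (G.exists_isLink_edge e).choose_spec

/-- The disjoint union of the vertices and of one copy of `[0, 1]` for each edge. -/
def Cells : Type _ := V(G) ⊕ (Σ _ : E(G), unitInterval)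

/-- The disjoint union topology; in particular the vertices form a discrete space. -/
instance Cells.instTopologicalSpace : TopologicalSpace G.Cells :=
  letI : TopologicalSpace V(G) := ⊥
  inferInstanceAs (TopologicalSpace (V(G) ⊕ (Σ _ : E(G), unitInterval)))

/-- The gluing of the end points of the interval of an edge to the ends of that edge. -/
inductive Glue : G.Cells → G.Cells → Prop
  | left (e : E(G)) : Glue (Sum.inr ⟨e, 0⟩) (Sum.inl (G.edgeEnds e).1)
  | right (e : E(G)) : Glue (Sum.inr ⟨e, 1⟩) (Sum.inl (G.edgeEnds e).2)

/-- The multigraph `G` as a topological space: the one-dimensional CW complex with one `0`-cell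
for each vertex and one `1`-cell for each edge, attached to the ends of that edge. `Quot` is the
quotient by the equivalence relation that `Glue` generates. -/
def Realization : Type _ := Quot G.Glue

instance Realization.instTopologicalSpace : TopologicalSpace G.Realization :=
  inferInstanceAs (TopologicalSpace (Quot G.Glue))

/-- The point of the space `G` that is the vertex `v`. -/
def vertexPoint (v : V(G)) : G.Realization := Quot.mk G.Glue (Sum.inl v)

end Graph

open Filter Topology Set
open scoped Manifold ContDiff
open EuclideanGeometry (inversion)

/-! Put one $m$-sphere for each vertex and one tube $S^{m-1} \times [0,1]$ for each edge, joining
the spheres of its two ends. Give the vertices distinct heights. Let $f$ be constant on each sphere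
outside the tubes, and let it pass strictly monotonically, by a smooth step function, from one end
height to the other along each tube. Looplessness makes the two end heights differ, so there are no
critical points inside the tubes. Every sphere carries an open set on which $f$ is constant, so
every vertex, even an isolated one, is the image of a critical point; all critical values are vertex
heights.

Collapsing each holed sphere to its vertex and each cross-section of a tube to a point gives a
continuous surjection $c : M \to G$, and $f$ is $c$ followed by a height on $G$. The fibres of $c$
are holed spheres or spheres $S^{m-1}$, connected because $m \ge 2$, while the height on $G$ has
finite fibres. By `exists_homeomorph_reebSpace` this makes $G$ the Reeb space.

All gluing is done by inversions between open subsets of $\mathbb{R}^m$. A sphere is two balls glued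
by inversion in a sphere of radius $R$; a tube is an annulus about a centre, glued by inversion in
the unit sphere there. The annuli at a piece are disjoint (`eq_of_annulus`) and inversions are
involutions, so the gluing relation is an equivalence; `eq_inversion_iff` shows that it is closed,
whence $M$ is Hausdorff.

To define $c$ and prove it continuous, $G$ is embedded in $\mathbb{R} \times \mathbb{R}^E$ by the
height and one bump per edge (`isEmbedding_coords`). The same coordinates exist on $M$ (`coordMap`),
and $c$ is determined by matching them (`exists_collapse`). -/

/-- Gluing data for a smooth manifold: finitely or infinitely many open subsets of `ℝ^m`, indexed
by labels, and an equivalence relation on their disjoint union which is closed, which identifies no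
two points with the same label and which is locally given by smooth maps. -/
structure SmoothGluing (m : ℕ) (J : Type) [TopologicalSpace J] where
  /-- The open subset of `ℝ^m` with a given label. -/
  dom : J → Set (EuclideanSpace ℝ (Fin m))
  isOpen_dom : ∀ j, IsOpen (dom j)
  /-- The equivalence relation by which the pieces are glued. -/
  rel : Setoid {z : J × EuclideanSpace ℝ (Fin m) // z.2 ∈ dom z.1}
  eq_of_rel : ∀ z w, rel z w → z.1.1 = w.1.1 → z = w
  exists_local : ∀ z w, rel z w → ∃ g : EuclideanSpace ℝ (Fin m) → EuclideanSpace ℝ (Fin m),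
    ContDiffAt ℝ ∞ g z.1.2 ∧ g z.1.2 = w.1.2 ∧ ∀ᶠ x in 𝓝 z.1.2, ∀ hx : x ∈ dom z.1.1,
      ∃ hy : g x ∈ dom w.1.1, rel ⟨(z.1.1, x), hx⟩ ⟨(w.1.1, g x), hy⟩
  isClosed_rel : IsClosed {p : {z : J × EuclideanSpace ℝ (Fin m) // z.2 ∈ dom z.1} ×
    {z : J × EuclideanSpace ℝ (Fin m) // z.2 ∈ dom z.1} | rel p.1 p.2}

/-! ### Manifolds glued from open subsets of Euclidean space -/

namespace SmoothGluing

variable {m : ℕ} {J : Type} [TopologicalSpace J] (S : SmoothGluing m J)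

/-- The disjoint union of the pieces. -/
abbrev Pieces : Type := {z : J × EuclideanSpace ℝ (Fin m) // z.2 ∈ S.dom z.1}

/-- The glued space. -/
def Space : Type := Quotient S.rel

instance : TopologicalSpace S.Space := inferInstanceAs (TopologicalSpace (Quotient S.rel))

/-- The point of the glued space given by a point of the piece with label `j`. -/
def pt (j : J) (x : EuclideanSpace ℝ (Fin m)) (hx : x ∈ S.dom j) : S.Space :=
  Quotient.mk S.rel ⟨(j, x), hx⟩

/-- The quotient map onto the glued space. -/
def proj (z : S.Pieces) : S.Space := Quotient.mk S.rel z

theorem proj_surjective : Function.Surjective S.proj := Quotient.mk_surjective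

theorem exists_eq_pt (z : S.Space) : ∃ j x, ∃ hx : x ∈ S.dom j, S.pt j x hx = z := by
  obtain ⟨⟨⟨j, x⟩, hx⟩, rfl⟩ := S.proj_surjective z
  exact ⟨j, x, hx, rfl⟩

theorem pt_eq_pt {j k : J} {x y : EuclideanSpace ℝ (Fin m)} {hx : x ∈ S.dom j}
    {hy : y ∈ S.dom k} : S.pt j x hx = S.pt k y hy ↔ S.rel ⟨(j, x), hx⟩ ⟨(k, y), hy⟩ :=
  Quotient.eq

/-- A function on the glued space, given by a compatible family of functions on the pieces. -/
def lift {Y : Type*} (F : J → EuclideanSpace ℝ (Fin m) → Y)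
    (hF : ∀ z w, S.rel z w → F z.1.1 z.1.2 = F w.1.1 w.1.2) : S.Space → Y :=
  Quotient.lift (fun z : S.Pieces => F z.1.1 z.1.2) hF

theorem isQuotientMap_proj : IsQuotientMap S.proj := isQuotientMap_quot_mk

theorem continuous_label (j : J) :
    Continuous (fun x : S.dom j => (⟨(j, x.1), x.2⟩ : S.Pieces)) := by
  fun_prop

theorem continuous_pt (j : J) : Continuous (fun x : S.dom j => S.pt j x.1 x.2) :=
  S.isQuotientMap_proj.continuous.comp (S.continuous_label j)

theorem isPreconnected_image_pt {j : J} {s : Set (EuclideanSpace ℝ (Fin m))}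
    (hs : IsPreconnected s) (hj : s ⊆ S.dom j) :
    IsPreconnected {z | ∃ x, ∃ hx : x ∈ S.dom j, x ∈ s ∧ S.pt j x hx = z} := by
  have h1 : IsPreconnected ((↑) ⁻¹' s : Set (S.dom j)) := by
    rw [← IsInducing.subtypeVal.isPreconnected_image, Subtype.image_preimage_coe,
      inter_eq_right.2 hj]
    exact hs
  convert h1.image _ (S.continuous_pt j).continuousOn using 1
  ext z
  simp

theorem isCompact_image_pt {j : J} {s : Set (EuclideanSpace ℝ (Fin m))}
    (hs : IsCompact s) (hj : s ⊆ S.dom j) :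
    IsCompact {z | ∃ x, ∃ hx : x ∈ S.dom j, x ∈ s ∧ S.pt j x hx = z} := by
  have h1 : IsCompact ((↑) ⁻¹' s : Set (S.dom j)) := by
    rw [IsInducing.subtypeVal.isCompact_iff, Subtype.image_preimage_coe, inter_eq_right.2 hj]
    exact hs
  convert h1.image (S.continuous_pt j) using 1
  ext z
  simp

variable [DiscreteTopology J]

theorem isOpen_label_image (j : J) {U : Set (EuclideanSpace ℝ (Fin m))} (hU : IsOpen U) :
    IsOpen {z : S.Pieces | z.1.1 = j ∧ z.1.2 ∈ U} := by
  have h1 : IsOpen {z : J × EuclideanSpace ℝ (Fin m) | z.1 = j ∧ z.2 ∈ U} :=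
    ((isOpen_discrete {j}).preimage continuous_fst).inter (hU.preimage continuous_snd)
  exact h1.preimage continuous_subtype_val

/-- The saturation of an open set is open: if $z$ is equivalent to a point of $U$, the local gluing
map moves a whole neighbourhood of $z$ into $U$. -/
theorem isOpenMap_proj : IsOpenMap S.proj := by
  intro U hU
  rw [← S.isQuotientMap_proj.isOpen_preimage, isOpen_iff_mem_nhds]
  rintro z ⟨w, hw, hwz⟩
  obtain ⟨g, hg, hgw, hev⟩ := S.exists_local z w (Quotient.exact hwz.symm)
  obtain ⟨O, hO, rfl⟩ := isOpen_induced_iff.1 hU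
  have h1 : ∀ᶠ x in 𝓝 z.1.2, (w.1.1, g x) ∈ O := by
    have : ContinuousAt (fun x => (w.1.1, g x)) z.1.2 := by
      have := hg.continuousAt
      fun_prop
    apply this.eventually_mem
    rw [hgw]
    exact hO.mem_nhds hw
  obtain ⟨N, hN, hNo, hzN⟩ := eventually_nhds_iff.1 (h1.and hev)
  refine mem_of_superset ((S.isOpen_label_image z.1.1 hNo).mem_nhds ⟨rfl, hzN⟩) ?_
  rintro ⟨⟨j, x⟩, hx⟩ ⟨hj, hxN⟩
  obtain rfl : j = z.1.1 := hj
  obtain ⟨hxO, hx'⟩ := hN x hxN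
  obtain ⟨hy, hr⟩ := hx' hx
  exact ⟨⟨(w.1.1, g x), hy⟩, hxO, Quotient.sound (S.rel.symm hr)⟩

theorem isOpenQuotientMap_proj : IsOpenQuotientMap S.proj :=
  ⟨S.proj_surjective, S.isQuotientMap_proj.continuous, S.isOpenMap_proj⟩

/-- The diagonal pulls back to the gluing relation under an open quotient map, and that relation is
closed. -/
instance : T2Space S.Space := by
  rw [t2_iff_isClosed_diagonal,
    ← (S.isOpenQuotientMap_proj.prodMap S.isOpenQuotientMap_proj).isQuotientMap.isClosed_preimage]
  convert S.isClosed_rel using 1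
  ext p
  exact Quotient.eq

theorem isOpenEmbedding_pt (j : J) : IsOpenEmbedding (fun x : S.dom j => S.pt j x.1 x.2) := by
  refine .of_continuous_injective_isOpenMap (S.continuous_pt j) ?_ ?_
  · intro x y hxy
    have := S.eq_of_rel _ _ (S.pt_eq_pt.1 hxy) rfl
    simp only [Subtype.mk.injEq, Prod.mk.injEq, true_and] at this
    exact Subtype.ext this
  · intro U hU
    obtain ⟨O, hO, rfl⟩ := isOpen_induced_iff.1 hU
    convert S.isOpenMap_proj _ (S.isOpen_label_image j hO) using 1
    ext z
    constructor
    · rintro ⟨x, hx, rfl⟩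
      exact ⟨⟨(j, x.1), x.2⟩, ⟨rfl, hx⟩, rfl⟩
    · rintro ⟨⟨⟨i, x⟩, hx⟩, ⟨hi, hxO⟩, rfl⟩
      obtain rfl : i = j := hi
      exact ⟨⟨x, hx⟩, hxO, rfl⟩

/-- The chart of the glued space given by the piece with label `j`. -/
noncomputable def chart (j : J) [Nonempty (S.dom j)] :
    OpenPartialHomeomorph S.Space (EuclideanSpace ℝ (Fin m)) :=
  ((S.isOpenEmbedding_pt j).toOpenPartialHomeomorph _).symm.trans
    ((S.isOpen_dom j).isOpenEmbedding_subtypeVal.toOpenPartialHomeomorph _)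

variable {S}

theorem chart_target (j : J) [Nonempty (S.dom j)] : (S.chart j).target = S.dom j := by
  simp [chart]

theorem chart_source (j : J) [Nonempty (S.dom j)] :
    (S.chart j).source = range (fun x : S.dom j => S.pt j x.1 x.2) := by
  simp [chart]

theorem chart_symm_apply {j : J} [Nonempty (S.dom j)] {x : EuclideanSpace ℝ (Fin m)}
    (hx : x ∈ S.dom j) : (S.chart j).symm x = S.pt j x hx := by
  have := (S.isOpen_dom j).isOpenEmbedding_subtypeVal.toOpenPartialHomeomorph_left_inv _
    (x := ⟨x, hx⟩)
  simp only [chart, OpenPartialHomeomorph.trans_symm_eq_symm_trans_symm,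
    OpenPartialHomeomorph.symm_symm, OpenPartialHomeomorph.coe_trans, Function.comp_apply]
  rw [this]
  simp

theorem chart_pt {j : J} [Nonempty (S.dom j)] {x : EuclideanSpace ℝ (Fin m)}
    (hx : x ∈ S.dom j) : S.chart j (S.pt j x hx) = x := by
  rw [← chart_symm_apply hx]
  exact (S.chart j).right_inv (by rwa [chart_target])

theorem pt_mem_chart_source {j : J} [Nonempty (S.dom j)] {x : EuclideanSpace ℝ (Fin m)}
    (hx : x ∈ S.dom j) : S.pt j x hx ∈ (S.chart j).source := by
  rw [chart_source]
  exact ⟨⟨x, hx⟩, rfl⟩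

variable (S)

noncomputable instance : ChartedSpace (EuclideanSpace ℝ (Fin m)) S.Space where
  atlas := {e | ∃ (j : J) (_ : Nonempty (S.dom j)), e = S.chart j}
  chartAt z :=
    have : Nonempty (S.dom (Quotient.out z).1.1) := ⟨⟨_, (Quotient.out z).2⟩⟩
    S.chart (Quotient.out z).1.1
  mem_chart_source z := by
    have h := Quotient.out_eq z
    have : Nonempty (S.dom (Quotient.out z).1.1) := ⟨⟨_, (Quotient.out z).2⟩⟩
    rw [chart_source]
    exact ⟨⟨_, (Quotient.out z).2⟩, h⟩
  chart_mem_atlas z := ⟨_, _, rfl⟩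

theorem chart_mem_atlas (j : J) [h : Nonempty (S.dom j)] :
    S.chart j ∈ atlas (EuclideanSpace ℝ (Fin m)) S.Space := ⟨j, h, rfl⟩

/-- Near each point a transition map agrees with the smooth map supplied by `exists_local`, since a
class has at most one point with a given label. -/
instance : IsManifold (𝓡 m) ∞ S.Space := by
  refine isManifold_of_contDiffOn _ _ _ ?_
  rintro _ _ ⟨j, hj, rfl⟩ ⟨k, hk, rfl⟩
  simp only [modelWithCornersSelf_coe, modelWithCornersSelf_coe_symm, Function.comp_id,
    Function.id_comp, preimage_id, range_id, inter_univ]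
  rintro x hx
  simp only [OpenPartialHomeomorph.trans_source, OpenPartialHomeomorph.symm_source, chart_target,
    mem_inter_iff, mem_preimage] at hx
  obtain ⟨hxj, hxk⟩ := hx
  rw [chart_symm_apply hxj, chart_source] at hxk
  obtain ⟨⟨y, hy⟩, hyx⟩ := hxk
  obtain ⟨g, hg, -, hev⟩ := S.exists_local _ _ (S.pt_eq_pt.1 hyx.symm)
  refine (hg.congr_of_eventuallyEq ?_).contDiffWithinAt
  filter_upwards [hev, (S.isOpen_dom j).mem_nhds hxj] with x' h1 h2
  obtain ⟨h3, h4⟩ := h1 h2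
  simp only [OpenPartialHomeomorph.coe_trans, Function.comp_apply]
  rw [chart_symm_apply h2, S.pt_eq_pt.2 h4, chart_pt]

variable {S}

theorem continuous_of_forall {Y : Type*} [TopologicalSpace Y] {f : S.Space → Y}
    {F : J → EuclideanSpace ℝ (Fin m) → Y} (hF : ∀ j, ContinuousOn (F j) (S.dom j))
    (hf : ∀ j x (hx : x ∈ S.dom j), f (S.pt j x hx) = F j x) : Continuous f := by
  rw [continuous_iff_continuousAt]
  intro z
  obtain ⟨j, x, hx, rfl⟩ := S.exists_eq_pt z
  rw [← (S.isOpenEmbedding_pt j).continuousAt_iff (x := ⟨x, hx⟩)]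
  refine Continuous.continuousAt ?_
  convert (hF j).domRestrict using 1
  ext y
  exact hf j y.1 y.2

variable {f : S.Space → ℝ} {F : J → EuclideanSpace ℝ (Fin m) → ℝ}

theorem contMDiff_of_forall (hF : ∀ j x, x ∈ S.dom j → ContDiffAt ℝ ∞ (F j) x)
    (hf : ∀ j x (hx : x ∈ S.dom j), f (S.pt j x hx) = F j x) :
    ContMDiff (𝓡 m) 𝓘(ℝ, ℝ) ∞ f := by
  intro z
  obtain ⟨j, x, hx, rfl⟩ := S.exists_eq_pt z
  have : Nonempty (S.dom j) := ⟨⟨x, hx⟩⟩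
  have h1 : ContMDiffAt (𝓡 m) 𝓘(ℝ, ℝ) ∞ (F j ∘ S.chart j) (S.pt j x hx) := by
    refine ContMDiffAt.comp _ (ContDiffAt.contMDiffAt ?_)
      (contMDiffAt_of_mem_maximalAtlas
        (IsManifold.subset_maximalAtlas (S.chart_mem_atlas j)) (pt_mem_chart_source hx))
    rw [chart_pt]
    exact hF j x hx
  refine h1.congr_of_eventuallyEq ?_
  filter_upwards [(S.chart j).open_source.mem_nhds (pt_mem_chart_source hx)] with w hw
  rw [chart_source] at hw
  obtain ⟨⟨y, hy⟩, rfl⟩ := hw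
  simp only [Function.comp_apply, chart_pt, hf]

/-- The chain rule, applied to the chart in one direction and to its inverse in the other. -/
theorem pt_mem_criticalPoints_iff (hF : ∀ j x, x ∈ S.dom j → ContDiffAt ℝ ∞ (F j) x)
    (hf : ∀ j x (hx : x ∈ S.dom j), f (S.pt j x hx) = F j x) {j : J}
    {x : EuclideanSpace ℝ (Fin m)} (hx : x ∈ S.dom j) :
    S.pt j x hx ∈ criticalPoints m f ↔ fderiv ℝ (F j) x = 0 := by
  have : Nonempty (S.dom j) := ⟨⟨x, hx⟩⟩
  have hs := contMDiff_of_forall hF hf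
  have hat : S.chart j ∈ IsManifold.maximalAtlas (𝓡 m) ∞ S.Space :=
    IsManifold.subset_maximalAtlas (S.chart_mem_atlas j)
  have hsymm : MDifferentiableAt (𝓡 m) (𝓡 m) (S.chart j).symm x :=
    (contMDiffOn_symm_of_mem_maximalAtlas hat).contMDiffAt
      ((S.chart j).open_target.mem_nhds (by rwa [chart_target])) |>.mdifferentiableAt (by simp)
  have hch : MDifferentiableAt (𝓡 m) (𝓡 m) (S.chart j) (S.pt j x hx) :=
    (contMDiffAt_of_mem_maximalAtlas hat (pt_mem_chart_source hx)).mdifferentiableAt (by simp)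
  have hfd : MDifferentiableAt (𝓡 m) 𝓘(ℝ, ℝ) f (S.pt j x hx) :=
    (hs _).mdifferentiableAt (by simp)
  have hFd : MDifferentiableAt (𝓡 m) 𝓘(ℝ, ℝ) (F j) x :=
    ((hF j x hx).differentiableAt (by simp)).mdifferentiableAt
  have e1 : F j =ᶠ[𝓝 x] f ∘ (S.chart j).symm := by
    filter_upwards [(S.isOpen_dom j).mem_nhds hx] with y hy
    simp only [Function.comp_apply, chart_symm_apply hy, hf]
  have e2 : f =ᶠ[𝓝 (S.pt j x hx)] F j ∘ S.chart j := by
    filter_upwards [(S.chart j).open_source.mem_nhds (pt_mem_chart_source hx)] with w hw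
    rw [chart_source] at hw
    obtain ⟨⟨y, hy⟩, rfl⟩ := hw
    simp only [Function.comp_apply, chart_pt, hf]
  rw [← mfderiv_eq_fderiv]
  constructor
  · intro h0
    have h1 : HasMFDerivAt (𝓡 m) 𝓘(ℝ, ℝ) f ((S.chart j).symm x) 0 := by
      rw [chart_symm_apply hx, ← show mfderiv (𝓡 m) 𝓘(ℝ, ℝ) f (S.pt j x hx) = 0 from h0]
      exact hfd.hasMFDerivAt
    exact ((h1.comp x hsymm.hasMFDerivAt).congr_of_eventuallyEq e1).mfderiv.trans
      (ContinuousLinearMap.zero_comp _)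
  · intro h0
    have h1 : HasMFDerivAt (𝓡 m) 𝓘(ℝ, ℝ) (F j) (S.chart j (S.pt j x hx)) 0 := by
      rw [chart_pt]
      exact hFd.hasMFDerivAt.congr_mfderiv h0
    exact ((h1.comp _ hch.hasMFDerivAt).congr_of_eventuallyEq e2).mfderiv.trans
      (ContinuousLinearMap.zero_comp _)

end SmoothGluing

/-! ### Recognising a Reeb space -/

section ReebHomeomorph

variable {M Y : Type*} [TopologicalSpace M] [TopologicalSpace Y]

theorem Topology.IsQuotientMap.exists_homeomorph_quotient {c : M → Y} (hc : IsQuotientMap c)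
    (r : Setoid M) (hr : ∀ x y, r x y ↔ c x = c y) :
    ∃ φ : Y ≃ₜ Quotient r, ∀ z, φ (c z) = Quotient.mk r z := by
  obtain rfl : r = Setoid.ker c := Setoid.ext hr
  let c' : C(M, Y) := ⟨c, hc.continuous⟩
  have hc' : IsQuotientMap c' := hc
  refine ⟨hc'.homeomorph.symm, fun z => ?_⟩
  rw [Homeomorph.symm_apply_eq]
  rfl

/-- If `f` factors through a Hausdorff space `Y` by a continuous surjection with connected fibres,
followed by a map with finite fibres, then `Y` is the Reeb space of `f`. -/
theorem exists_homeomorph_reebSpace [CompactSpace M] [T2Space Y] {f : M → ℝ} {c : M → Y}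
    (hc : Continuous c) (hsurj : Function.Surjective c) {h : Y → ℝ} (hf : ∀ z, f z = h (c z))
    (hfin : ∀ t, (h ⁻¹' {t}).Finite) (hconn : ∀ y, IsPreconnected (c ⁻¹' {y})) :
    ∃ φ : Y ≃ₜ ReebSpace f, ∀ z, φ (c z) = reebProj f z := by
  refine (IsQuotientMap.of_surjective_continuous hsurj hc).exists_homeomorph_quotient
    (reebSetoid f) fun x y => ⟨?_, ?_⟩
  -- The image in `Y` of a level set component is connected and lies in a finite fibre of `h`, so it
  -- is a single point.
  · rintro ⟨-, hy⟩
    have h1 : IsPreconnected (c '' connectedComponentIn (f ⁻¹' {f x}) x) :=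
      isPreconnected_connectedComponentIn.image c hc.continuousOn
    by_contra hne
    refine h1.infinite_of_nontrivial ⟨c x, ⟨x, mem_connectedComponentIn (by simp), rfl⟩, c y,
      ⟨y, hy, rfl⟩, hne⟩ ((hfin (f x)).subset ?_)
    rintro _ ⟨w, hw, rfl⟩
    have := connectedComponentIn_subset _ _ hw
    simpa [← hf] using this
  -- The fibre of `c` through `x` is connected and contained in the level set of `f`, hence in one
  -- component.
  · intro hxy
    have hfxy : f x = f y := by rw [hf, hf, hxy]
    refine ⟨hfxy, ((hconn (c x)).subset_connectedComponentIn (x := x) rfl ?_) hxy.symm⟩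
    intro w hw
    have hw' : c w = c x := hw
    simp [hf, hw']

end ReebHomeomorph

/-! ### The smooth step function -/

namespace Real

/-- On $(0,1)$ the function equals $(1 + \exp(1/x - 1/(1-x)))^{-1}$, and the exponent has negative
derivative. -/
theorem exists_hasDerivAt_smoothTransition {x : ℝ} (h0 : 0 < x) (h1 : x < 1) :
    ∃ d, 0 < d ∧ HasDerivAt smoothTransition d x := by
  have hd : HasDerivAt (fun y : ℝ => (1 + exp (y⁻¹ - (1 - y)⁻¹))⁻¹)
      (-(exp (x⁻¹ - (1 - x)⁻¹) * (-1 / x ^ 2 - (- (-1)) / (1 - x) ^ 2)) /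
        (1 + exp (x⁻¹ - (1 - x)⁻¹)) ^ 2) x := by
    have a1 : HasDerivAt (fun y : ℝ => y⁻¹) (-1 / x ^ 2) x := (hasDerivAt_id x).inv h0.ne'
    have a2 : HasDerivAt (fun y : ℝ => (1 - y)⁻¹) (- (-1) / (1 - x) ^ 2) x :=
      ((hasDerivAt_id x).const_sub 1).inv (sub_pos.2 h1).ne'
    exact ((a1.sub a2).exp.const_add 1).inv (by positivity)
  refine ⟨_, ?_, hd.congr_of_eventuallyEq ?_⟩
  · refine div_pos (neg_pos.2 (mul_neg_of_pos_of_neg (exp_pos _) ?_)) (by positivity)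
    have b1 : 0 < 1 / x ^ 2 := by positivity
    have b2 : 0 < 1 / (1 - x) ^ 2 := by
      have := sub_pos.2 h1
      positivity
    rw [neg_neg, neg_div]
    linarith
  · filter_upwards [Ioo_mem_nhds h0 h1] with y hy
    have c1 : ¬ y ≤ 0 := not_le.2 hy.1
    have c2 : ¬ 1 - y ≤ 0 := not_le.2 (sub_pos.2 hy.2)
    simp only [smoothTransition, expNegInvGlue, if_neg c1, if_neg c2]
    rw [sub_eq_add_neg y⁻¹, exp_add, div_eq_iff (by positivity), inv_mul_eq_div,
      eq_div_iff (by positivity), exp_neg, exp_neg]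
    field_simp

theorem strictMonoOn_smoothTransition : StrictMonoOn smoothTransition (Icc 0 1) := by
  refine strictMonoOn_of_deriv_pos (convex_Icc 0 1) smoothTransition.continuous.continuousOn ?_
  intro x hx
  rw [interior_Icc] at hx
  obtain ⟨d, hd, h⟩ := exists_hasDerivAt_smoothTransition hx.1 hx.2
  rwa [h.deriv]

theorem smoothTransition_one_sub (x : ℝ) : smoothTransition (1 - x) = 1 - smoothTransition x := by
  have := smoothTransition.pos_denom x
  have h : smoothTransition (1 - x) =
      expNegInvGlue (1 - x) / (expNegInvGlue x + expNegInvGlue (1 - x)) := by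
    rw [smoothTransition, sub_sub_cancel, add_comm]
  rw [h, smoothTransition, eq_sub_iff_add_eq, ← add_div, add_comm, div_self this.ne']

end Real

/-! ### Embedding the space of a graph by a height and edge bumps -/

namespace Graph

variable {α β : Type*} (G : Graph α β)

/-- The point of the space `G` with parameter `t` on the edge `e`. -/
def edgePoint (e : E(G)) (t : unitInterval) : G.Realization := Quot.mk G.Glue (Sum.inr ⟨e, t⟩)

theorem edgePoint_zero (e : E(G)) : G.edgePoint e 0 = G.vertexPoint (G.edgeEnds e).1 :=
  Quot.sound (.left e)

theorem edgePoint_one (e : E(G)) : G.edgePoint e 1 = G.vertexPoint (G.edgeEnds e).2 :=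
  Quot.sound (.right e)

theorem exists_eq_vertexPoint_or_edgePoint (y : G.Realization) :
    (∃ v, y = G.vertexPoint v) ∨
      ∃ (e : E(G)) (t : unitInterval), 0 < (t : ℝ) ∧ (t : ℝ) < 1 ∧ y = G.edgePoint e t := by
  induction y using Quot.ind with | mk y => ?_
  obtain v | ⟨e, t⟩ := y
  · exact .inl ⟨v, rfl⟩
  · rcases t.2.1.eq_or_lt with h0 | h0
    · obtain rfl : t = 0 := Subtype.ext h0.symm
      exact .inl ⟨_, G.edgePoint_zero e⟩
    rcases t.2.2.eq_or_lt with h1 | h1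
    · obtain rfl : t = 1 := Subtype.ext h1
      exact .inl ⟨_, G.edgePoint_one e⟩
    exact .inr ⟨e, t, h0, h1, rfl⟩

theorem edgeEnds_ne [G.Loopless] (e : E(G)) : (G.edgeEnds e).1 ≠ (G.edgeEnds e).2 :=
  fun h => (G.isLink_edgeEnds e).ne (congrArg Subtype.val h)

variable (h : V(G) → ℝ)

open Classical in
/-- Coordinates on the space `G`: the smooth interpolation along the edges of a function on the
vertices, and a bump function on each edge. -/
noncomputable def coords : G.Realization → ℝ × (E(G) → ℝ) :=
  Quot.lift (Sum.elim (fun v => (h v, 0)) fun p =>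
      (h (G.edgeEnds p.1).1 + (h (G.edgeEnds p.1).2 - h (G.edgeEnds p.1).1) *
        Real.smoothTransition p.2, Pi.single p.1 (p.2 * (1 - p.2) : ℝ))) <| by
    rintro _ _ (e | e) <;> simp

theorem coords_vertexPoint (v : V(G)) : G.coords h (G.vertexPoint v) = (h v, 0) := rfl

open Classical in
theorem coords_edgePoint (e : E(G)) (t : unitInterval) : G.coords h (G.edgePoint e t) =
    (h (G.edgeEnds e).1 + (h (G.edgeEnds e).2 - h (G.edgeEnds e).1) *
        Real.smoothTransition t, Pi.single e (t * (1 - t) : ℝ)) := rfl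

open Classical in
theorem continuous_coords : Continuous (G.coords h) := by
  refine continuous_quot_lift _ ?_
  let _ : TopologicalSpace V(G) := ⊥
  have : DiscreteTopology V(G) := ⟨rfl⟩
  refine continuous_sum_dom.2 ⟨continuous_of_discreteTopology, continuous_sigma fun e => ?_⟩
  have h1 : Continuous fun t : unitInterval => Real.smoothTransition t :=
    Real.smoothTransition.continuous.comp continuous_subtype_val
  have h2 : Continuous fun t : unitInterval => (t * (1 - t) : ℝ) := by fun_prop
  refine .prodMk (by fun_prop) ?_
  exact (continuous_single e).comp h2

theorem compactSpace_realization [Finite V(G)] [Finite E(G)] : CompactSpace G.Realization := by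
  let _ : TopologicalSpace V(G) := ⊥
  have : DiscreteTopology V(G) := ⟨rfl⟩
  have : CompactSpace G.Cells := inferInstanceAs (CompactSpace (V(G) ⊕ (Σ _ : E(G), unitInterval)))
  exact Quot.compactSpace

variable {G h} [G.Loopless]

/-- Here looplessness enters: the two end heights differ, so the height is strictly monotone along
the edge. -/
theorem coords_fst_edgePoint_injective (hinj : Function.Injective h) (e : E(G)) :
    Function.Injective fun t => (G.coords h (G.edgePoint e t)).1 := by
  intro s t hst
  have hne : h (G.edgeEnds e).2 - h (G.edgeEnds e).1 ≠ 0 :=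
    sub_ne_zero.2 fun hh => G.edgeEnds_ne e (hinj hh).symm
  simp only [coords_edgePoint, add_right_inj] at hst
  exact Subtype.ext (Real.strictMonoOn_smoothTransition.injOn s.2 t.2 (mul_left_cancel₀ hne hst))

/-- All bumps vanish exactly at the vertices, which the height tells apart. At an interior point the
unique nonzero bump names the edge, and the height then gives the parameter. -/
theorem coords_injective (hinj : Function.Injective h) : Function.Injective (G.coords h) := by
  classical
  have key : ∀ (e : E(G)) (t : unitInterval), 0 < (t : ℝ) → (t : ℝ) < 1 →
      (t * (1 - t) : ℝ) ≠ 0 := fun e t h0 h1 => (mul_pos h0 (sub_pos.2 h1)).ne'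
  intro y z hyz
  rcases G.exists_eq_vertexPoint_or_edgePoint y with ⟨v, rfl⟩ | ⟨e, t, h0, h1, rfl⟩ <;>
  rcases G.exists_eq_vertexPoint_or_edgePoint z with ⟨w, rfl⟩ | ⟨i, s, k0, k1, rfl⟩
  · simp only [coords_vertexPoint, Prod.mk.injEq, and_true] at hyz
    rw [hinj hyz]
  · have := congrFun (congrArg Prod.snd hyz) i
    simp only [coords_vertexPoint, coords_edgePoint, Pi.single_eq_same] at this
    exact absurd this.symm (key i s k0 k1)
  · have := congrFun (congrArg Prod.snd hyz) e
    simp only [coords_vertexPoint, coords_edgePoint, Pi.single_eq_same] at this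
    exact absurd this (key e t h0 h1)
  · have hei : e = i := by
      by_contra hne
      have := congrFun (congrArg Prod.snd hyz) e
      simp only [coords_edgePoint, Pi.single_eq_same, Pi.single_eq_of_ne hne] at this
      exact absurd this (key e t h0 h1)
    subst hei
    rw [coords_fst_edgePoint_injective hinj e (congrArg Prod.fst hyz)]

theorem finite_coords_fst_preimage [Finite V(G)] [Finite E(G)] (hinj : Function.Injective h)
    (t : ℝ) : ((fun y => (G.coords h y).1) ⁻¹' {t}).Finite := by
  refine ((finite_range G.vertexPoint).union (finite_iUnion fun e : E(G) =>
    ((subsingleton_singleton (a := t)).preimage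
      (coords_fst_edgePoint_injective hinj e)).finite.image (G.edgePoint e))).subset ?_
  intro y hy
  rcases G.exists_eq_vertexPoint_or_edgePoint y with ⟨v, rfl⟩ | ⟨e, s, -, -, rfl⟩
  · exact .inl ⟨v, rfl⟩
  · exact .inr (mem_iUnion.2 ⟨e, s, hy, rfl⟩)

/-- A continuous injection from a compact space to a Hausdorff space. It makes the space of the
graph Hausdorff and lets continuity of maps into it be tested in coordinates. -/
theorem isEmbedding_coords [Finite V(G)] [Finite E(G)] (hinj : Function.Injective h) :
    IsEmbedding (G.coords h) :=
  have := G.compactSpace_realization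
  ((G.continuous_coords h).isClosedEmbedding (coords_injective hinj)).isEmbedding

end Graph

/-! ### The pieces of the manifold and the inversions that glue them -/

/-- Positions of tubes, one for each edge, which are far enough apart. The ends of an edge are
called its source and its target. -/
structure TubeConfig (m : ℕ) (V : Type) (E : Type*) where
  /-- The source of an edge. -/
  src : E → V
  /-- The target of an edge. -/
  tgt : E → V
  src_ne_tgt : ∀ e, src e ≠ tgt e
  /-- The place at which the tube of an edge is attached. -/
  center : E → EuclideanSpace ℝ (Fin m)
  /-- The radius of a ball that contains all those places. -/
  radius : ℝ
  radius_pos : 0 < radius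
  -- The two distance conditions make the open balls of radius 2 about the centres disjoint and
  -- place them inside the ball of radius $R/2$, clear of the annulus $R/2 < |x| < 2R$ used to close
  -- up the sphere.
  four_le_dist : ∀ e e', e ≠ e' → 4 ≤ dist (center e) (center e')
  dist_center_add_two_le : ∀ e, dist (center e) 0 + 2 ≤ radius / 2

namespace TubeConfig

variable {m : ℕ} {V : Type} {E : Type*} (C : TubeConfig m V E)

/-- The edge `e` ends at the vertex `v`. -/
def Inc (e : E) (v : V) : Prop := C.src e = v ∨ C.tgt e = v

theorem inc_src (e : E) : C.Inc e (C.src e) := .inl rfl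

theorem inc_tgt (e : E) : C.Inc e (C.tgt e) := .inr rfl

/-- Each vertex has two pieces, two balls whose union is a sphere; the tubes start in the first. -/
def dom (j : V × Bool) : Set (EuclideanSpace ℝ (Fin m)) :=
  {x | dist x 0 < 2 * C.radius ∧
    (j.2 = true → ∀ e, C.Inc e j.1 → 1 / 2 < dist x (C.center e))}

/-- The centres of the inversions by which the pieces are glued. -/
def linkCenter : E ⊕ V → EuclideanSpace ℝ (Fin m) := Sum.elim C.center fun _ => 0

/-- The radii of the inversions by which the pieces are glued. -/
def linkRadius : E ⊕ V → ℝ := Sum.elim (fun _ => 1) fun _ => C.radius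

/-- The pieces which are glued by an inversion: an edge joins the first pieces of its ends, and
a vertex its two pieces. -/
def Links : E ⊕ V → V × Bool → V × Bool → Prop
  | .inl e, j, k => j.2 = true ∧ k.2 = true ∧
      ((C.src e = j.1 ∧ C.tgt e = k.1) ∨ (C.tgt e = j.1 ∧ C.src e = k.1))
  | .inr v, j, k => j.1 = v ∧ k.1 = v ∧ j.2 ≠ k.2

theorem linkRadius_pos (l : E ⊕ V) : 0 < C.linkRadius l := by
  obtain e | v := l
  · exact one_pos
  · exact C.radius_pos

variable {C}

theorem Links.symm {l : E ⊕ V} {j k : V × Bool} (h : C.Links l j k) : C.Links l k j := by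
  obtain e | v := l
  · exact ⟨h.2.1, h.1, h.2.2.symm.imp And.symm And.symm⟩
  · exact ⟨h.2.1, h.1, h.2.2.symm⟩

theorem Links.ne {l : E ⊕ V} {j k : V × Bool} (h : C.Links l j k) : j ≠ k := by
  rintro rfl
  obtain e | v := l
  · rcases h.2.2 with ⟨h1, h2⟩ | ⟨h1, h2⟩
    · exact C.src_ne_tgt e (h1.trans h2.symm)
    · exact C.src_ne_tgt e (h2.trans h1.symm)
  · exact h.2.2 rfl

theorem Links.unique {l : E ⊕ V} {j k k' : V × Bool} (h : C.Links l j k) (h' : C.Links l j k') :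
    k = k' := by
  obtain ⟨j1, j2⟩ := j
  obtain ⟨k1, k2⟩ := k
  obtain ⟨i1, i2⟩ := k'
  obtain e | v := l
  · have := C.src_ne_tgt e
    simp only [Links] at h h'
    grind
  · simp only [Links] at h h'
    ext
    · simp [h.2.1, h'.2.1]
    · revert h h'
      cases j2 <;> cases k2 <;> cases i2 <;> simp

theorem center_dist_of_ne {e e' : E} (h : e ≠ e') {x : EuclideanSpace ℝ (Fin m)} {r : ℝ}
    (hx : dist x (C.center e) ≤ r) : 4 - r ≤ dist x (C.center e') := by
  have h1 := C.four_le_dist e e' h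
  have h2 := dist_triangle_left (C.center e) (C.center e') x
  linarith

theorem dist_zero_le {e : E} {x : EuclideanSpace ℝ (Fin m)} {r : ℝ}
    (hx : dist x (C.center e) ≤ r) : dist x 0 ≤ C.radius / 2 + r - 2 := by
  have h1 := C.dist_center_add_two_le e
  have h2 := dist_triangle x (C.center e) 0
  linarith

theorem dist_center_ge (e : E) (x : EuclideanSpace ℝ (Fin m)) :
    dist x 0 - C.radius / 2 + 2 ≤ dist x (C.center e) := by
  have h1 := C.dist_center_add_two_le e
  have h2 := dist_triangle x (C.center e) 0
  linarith

theorem isOpen_dom [Finite E] (j : V × Bool) : IsOpen (C.dom j) := by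
  have key : C.dom j = Metric.ball 0 (2 * C.radius) ∩
      ⋂ e : {e : E // j.2 = true ∧ C.Inc e j.1}, {x | 1 / 2 < dist x (C.center e)} := by
    ext x
    simp only [mem_inter_iff, Metric.mem_ball, mem_iInter, Subtype.forall]
    exact and_congr_right fun _ => ⟨fun h e he => h he.1 e he.2, fun h h1 e h2 => h e ⟨h1, h2⟩⟩
  rw [key]
  exact Metric.isOpen_ball.inter (isOpen_iInter_of_finite fun e =>
    isOpen_lt continuous_const (continuous_id.dist continuous_const))

theorem dist_inversion {l : E ⊕ V} {x : EuclideanSpace ℝ (Fin m)} :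
    dist (inversion (C.linkCenter l) (C.linkRadius l) x) (C.linkCenter l) =
      C.linkRadius l ^ 2 / dist x (C.linkCenter l) :=
  EuclideanGeometry.dist_inversion_center _ _ _

/-- A tube bounds the distance to the centre of inversion from below, a sphere closing bounds it
from above. Inversion exchanges the two kinds of bound, so applying this at both glued points
confines them to an annulus. -/
theorem Links.half_lt_dist_or {l : E ⊕ V} {j k : V × Bool} (h : C.Links l j k)
    {x : EuclideanSpace ℝ (Fin m)} (hx : x ∈ C.dom j) :
    (∃ e, l = .inl e ∧ C.linkRadius l / 2 < dist x (C.linkCenter l)) ∨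
      ∃ v, l = .inr v ∧ dist x (C.linkCenter l) < 2 * C.linkRadius l := by
  obtain e | v := l
  · refine .inl ⟨e, rfl, ?_⟩
    exact hx.2 h.1 e (h.2.2.imp And.left And.left)
  · exact .inr ⟨v, rfl, hx.1⟩

/-- Points that are glued lie in an annulus around the centre of the inversion. -/
theorem Links.mem_annulus {l : E ⊕ V} {j k : V × Bool} (h : C.Links l j k)
    {x : EuclideanSpace ℝ (Fin m)} (hx : x ∈ C.dom j) (hxc : x ≠ C.linkCenter l)
    (hy : inversion (C.linkCenter l) (C.linkRadius l) x ∈ C.dom k) :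
    C.linkRadius l / 2 < dist x (C.linkCenter l) ∧
      dist x (C.linkCenter l) < 2 * C.linkRadius l := by
  have hd : 0 < dist x (C.linkCenter l) := dist_pos.2 hxc
  have hρ := C.linkRadius_pos l
  have h1 := h.half_lt_dist_or hx
  have h2 := h.symm.half_lt_dist_or hy
  rw [dist_inversion, lt_div_iff₀ hd, div_lt_iff₀ hd] at h2
  rcases h1 with ⟨e, rfl, h1⟩ | ⟨v, rfl, h1⟩
  · rcases h2 with ⟨e', -, h2⟩ | ⟨v, h', -⟩
    · exact ⟨h1, by nlinarith⟩
    · cases h'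
  · rcases h2 with ⟨e, h', -⟩ | ⟨v', -, h2⟩
    · cases h'
    · exact ⟨by nlinarith, h1⟩

/-- The annulus is invariant under its inversion and stays away from the other holes, so the image
satisfies every condition defining the target piece. -/
theorem Links.inversion_mem {l : E ⊕ V} {j k : V × Bool} (h : C.Links l j k)
    {x : EuclideanSpace ℝ (Fin m)} (h1 : C.linkRadius l / 2 < dist x (C.linkCenter l))
    (h2 : dist x (C.linkCenter l) < 2 * C.linkRadius l) :
    inversion (C.linkCenter l) (C.linkRadius l) x ∈ C.dom k := by
  have hρ := C.linkRadius_pos l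
  have hd : 0 < dist x (C.linkCenter l) := by linarith
  have h3 : C.linkRadius l / 2 <
      dist (inversion (C.linkCenter l) (C.linkRadius l) x) (C.linkCenter l) := by
    rw [dist_inversion, lt_div_iff₀ hd]
    nlinarith
  have h4 : dist (inversion (C.linkCenter l) (C.linkRadius l) x) (C.linkCenter l) <
      2 * C.linkRadius l := by
    rw [dist_inversion, div_lt_iff₀ hd]
    nlinarith
  have hR := C.radius_pos
  obtain e | v := l
  · change 1 / 2 < dist _ (C.center e) at h3
    change dist _ (C.center e) < 2 * 1 at h4
    refine ⟨by linarith [C.dist_zero_le h4.le], fun _ e' _ => ?_⟩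
    by_cases he : e = e'
    · subst he
      exact h3
    · linarith [C.center_dist_of_ne he h4.le]
  · change C.radius / 2 < dist _ 0 at h3
    refine ⟨h4, fun _ e _ => ?_⟩
    linarith [C.dist_center_ge e (inversion (C.linkCenter (.inr v)) (C.linkRadius (.inr v)) x)]

/-- The annuli at one piece are disjoint by the choice of distances: a point takes part in at most
one gluing. Transitivity of the gluing relation rests on this. -/
theorem eq_of_annulus {l l' : E ⊕ V} {j k k' : V × Bool} (h : C.Links l j k)
    (h' : C.Links l' j k') {x : EuclideanSpace ℝ (Fin m)}
    (hx : C.linkRadius l / 2 < dist x (C.linkCenter l) ∧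
      dist x (C.linkCenter l) < 2 * C.linkRadius l)
    (hx' : C.linkRadius l' / 2 < dist x (C.linkCenter l') ∧
      dist x (C.linkCenter l') < 2 * C.linkRadius l') : l = l' := by
  obtain e | v := l <;> obtain e' | v' := l'
  · by_contra hne
    change _ < dist x (C.center e) ∧ dist x (C.center e) < 2 * 1 at hx
    change _ < dist x (C.center e') ∧ dist x (C.center e') < 2 * 1 at hx'
    linarith [C.center_dist_of_ne (fun hh => hne (congrArg _ hh)) hx.2.le]
  · change _ < dist x (C.center e) ∧ dist x (C.center e) < 2 * 1 at hx
    change C.radius / 2 < dist x 0 ∧ _ at hx'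
    linarith [C.dist_zero_le hx.2.le]
  · change _ < dist x (C.center e') ∧ dist x (C.center e') < 2 * 1 at hx'
    change C.radius / 2 < dist x 0 ∧ _ at hx
    linarith [C.dist_zero_le hx'.2.le]
  · exact congrArg _ (h.1.symm.trans h'.1)

variable (C)

/-- Two points of pieces are identified when some inversion takes one to the other. -/
def setoid : Setoid {z : (V × Bool) × EuclideanSpace ℝ (Fin m) // z.2 ∈ C.dom z.1} where
  r z w := z = w ∨ ∃ l, C.Links l z.1.1 w.1.1 ∧ z.1.2 ≠ C.linkCenter l ∧
    w.1.2 = inversion (C.linkCenter l) (C.linkRadius l) z.1.2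
  iseqv := by
    refine ⟨fun z => .inl rfl, ?_, ?_⟩
    · rintro z w (rfl | ⟨l, hl, hz, hw⟩)
      · exact .inl rfl
      · refine .inr ⟨l, hl.symm, ?_, ?_⟩
        · rwa [hw, Ne, EuclideanGeometry.inversion_eq_center (C.linkRadius_pos l).ne']
        · rw [hw, EuclideanGeometry.inversion_inversion _ (C.linkRadius_pos l).ne']
    · rintro z w u (rfl | ⟨l, hl, hz, hw⟩)
      · exact id
      rintro (rfl | ⟨l', hl', hw', hu⟩)
      · exact .inr ⟨l, hl, hz, hw⟩
      have hρ := (C.linkRadius_pos l).ne'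
      have hzw : z.1.2 = inversion (C.linkCenter l) (C.linkRadius l) w.1.2 := by
        rw [hw, EuclideanGeometry.inversion_inversion _ hρ]
      have hwc : w.1.2 ≠ C.linkCenter l := by
        rwa [hw, Ne, EuclideanGeometry.inversion_eq_center hρ]
      -- The middle point lies in the annuli of both links, so the links coincide; the inversion is
      -- applied twice and leads back to the starting point.
      have a1 := hl.symm.mem_annulus w.2 hwc (hzw ▸ z.2)
      have a2 := hl'.mem_annulus w.2 hw' (hu ▸ u.2)
      obtain rfl := C.eq_of_annulus hl.symm hl' a1 a2
      refine .inl (Subtype.ext (Prod.ext (hl.symm.unique hl') ?_))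
      rw [hu, hzw]

theorem setoid_iff {z w : {z : (V × Bool) × EuclideanSpace ℝ (Fin m) // z.2 ∈ C.dom z.1}} :
    C.setoid z w ↔ z = w ∨ ∃ l, C.Links l z.1.1 w.1.1 ∧ z.1.2 ≠ C.linkCenter l ∧
      w.1.2 = inversion (C.linkCenter l) (C.linkRadius l) z.1.2 := Iff.rfl

/-- The right side consists of equations between continuous functions, hence is a closed condition;
its first equation already excludes $x = c$, because $\rho^2 > 0$. -/
theorem eq_inversion_iff {c x y : EuclideanSpace ℝ (Fin m)} {ρ : ℝ} (hρ : 0 < ρ) :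
    (x ≠ c ∧ y = inversion c ρ x) ↔
      dist x c * dist y c = ρ ^ 2 ∧ dist x c ^ 2 • (y - c) = ρ ^ 2 • (x - c) := by
  constructor
  · rintro ⟨hx, rfl⟩
    have hd := dist_ne_zero.2 hx
    refine ⟨?_, ?_⟩
    · rw [EuclideanGeometry.dist_inversion_center]
      field_simp
    · simp only [EuclideanGeometry.inversion, vsub_eq_sub, vadd_eq_add, add_sub_cancel_right,
        smul_smul]
      congr 1
      field_simp
  · rintro ⟨h1, h2⟩
    have hx : x ≠ c := by
      rintro rfl
      rw [dist_self, zero_mul] at h1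
      exact (pow_pos hρ 2).ne h1
    have hd := dist_ne_zero.2 hx
    refine ⟨hx, ?_⟩
    have h3 : y - c = (ρ / dist x c) ^ 2 • (x - c) := by
      rw [div_pow, div_eq_inv_mul, mul_smul, ← h2, inv_smul_smul₀ (pow_ne_zero 2 hd)]
    simp only [EuclideanGeometry.inversion, vsub_eq_sub, vadd_eq_add]
    rw [← h3, sub_add_cancel]

variable [TopologicalSpace V] [DiscreteTopology V] [Finite V] [Finite E]

theorem isClosed_setoid :
    IsClosed {p : {z : (V × Bool) × EuclideanSpace ℝ (Fin m) // z.2 ∈ C.dom z.1} ×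
      {z : (V × Bool) × EuclideanSpace ℝ (Fin m) // z.2 ∈ C.dom z.1} | C.setoid p.1 p.2} := by
  simp only [setoid_iff, eq_inversion_iff (C.linkRadius_pos _), ofPred_or, ofPred_exists]
  refine isClosed_diagonal.union (isClosed_iUnion_of_finite fun l => ?_)
  refine IsClosed.inter ?_ (IsClosed.inter ?_ ?_)
  · have h1 : IsClosed {q : (V × Bool) × (V × Bool) | C.Links l q.1 q.2} := isClosed_discrete _
    exact h1.preimage (f := fun p :
      {z : (V × Bool) × EuclideanSpace ℝ (Fin m) // z.2 ∈ C.dom z.1} ×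
      {z : (V × Bool) × EuclideanSpace ℝ (Fin m) // z.2 ∈ C.dom z.1} => (p.1.1.1, p.2.1.1))
      (by fun_prop)
  · exact isClosed_eq (by fun_prop) (by fun_prop)
  · exact isClosed_eq (by fun_prop) (by fun_prop)

/-- The gluing of the pieces. -/
def gluing : SmoothGluing m (V × Bool) where
  dom := C.dom
  isOpen_dom := C.isOpen_dom
  rel := C.setoid
  eq_of_rel := by
    rintro z w (h | ⟨l, hl, -⟩) hzw
    · exact h
    · exact absurd hzw hl.ne
  exists_local := by
    rintro z w (rfl | ⟨l, hl, hz, hw⟩)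
    · exact ⟨id, contDiffAt_id, rfl, .of_forall fun x hx => ⟨hx, C.setoid.refl _⟩⟩
    · have hc : ContDiffAt ℝ ∞ (inversion (C.linkCenter l) (C.linkRadius l)) z.1.2 :=
        contDiffAt_const.inversion contDiffAt_const contDiffAt_id hz
      refine ⟨_, hc, hw.symm, ?_⟩
      have h1 : ∀ᶠ x in 𝓝 z.1.2,
          inversion (C.linkCenter l) (C.linkRadius l) x ∈ C.dom w.1.1 :=
        hc.continuousAt.eventually_mem ((C.isOpen_dom _).mem_nhds (hw ▸ w.2))
      filter_upwards [h1, isOpen_ne.mem_nhds hz] with x hx1 hx2 hx3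
      exact ⟨hx1, .inr ⟨l, hl, hx2, rfl⟩⟩
  isClosed_rel := C.isClosed_setoid

end TubeConfig

/-! ### The height function and the edge bumps on the manifold -/

namespace TubeConfig

/-- The parameter along a tube, as a function of the distance from the place where the tube is
attached; inside the tube it lies between `0` and `1`. -/
noncomputable def param (r : ℝ) : ℝ := 1 / 2 - 2 * Real.log r

theorem param_le_zero_iff {r : ℝ} (hr : 0 < r) : param r ≤ 0 ↔ Real.exp (1 / 4) ≤ r := by
  rw [param, ← Real.le_log_iff_exp_le hr]
  constructor <;> intro h <;> linarith

theorem param_lt_one_iff {r : ℝ} (hr : 0 < r) : param r < 1 ↔ Real.exp (-(1 / 4)) < r := by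
  rw [param, ← Real.lt_log_iff_exp_lt hr]
  constructor <;> intro h <;> linarith

/-- The logarithm turns the inversion $r \mapsto 1/r$ into the reversal $t \mapsto 1 - t$ of the
edge. The factor 2 in `param` puts the active part $e^{-1/4} < r < e^{1/4}$ of the tube well inside
the glued annulus $1/2 < r < 2$. -/
theorem param_inv (r : ℝ) : param r⁻¹ = 1 - param r := by
  rw [param, param, Real.log_inv]
  ring

theorem one_lt_exp_quarter : 1 < Real.exp (1 / 4) := Real.one_lt_exp_iff.2 (by norm_num)

theorem exp_quarter_lt_two : Real.exp (1 / 4) < 2 := by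
  rw [← Real.lt_log_iff_exp_lt two_pos]
  linarith [Real.log_two_gt_d9]

theorem half_lt_exp_neg_quarter : 1 / 2 < Real.exp (-(1 / 4)) := by
  rw [Real.exp_neg, one_div]
  exact inv_strictAnti₀ (Real.exp_pos _) exp_quarter_lt_two

theorem param_le_zero {r : ℝ} (hr : 2 ≤ r) : param r ≤ 0 :=
  (param_le_zero_iff (by linarith)).2 (exp_quarter_lt_two.le.trans hr)

theorem contDiffAt_param {r : ℝ} (hr : r ≠ 0) : ContDiffAt ℝ ∞ param r :=
  contDiffAt_const.sub (contDiffAt_const.mul (Real.contDiffAt_log.2 hr))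

/-- A bump function with support in the interval `[0, 1]`. -/
noncomputable def tent (t : ℝ) : ℝ :=
  (projIcc 0 1 zero_le_one t : ℝ) * (1 - (projIcc 0 1 zero_le_one t : ℝ))

theorem continuous_tent : Continuous tent := by
  have : Continuous fun t : ℝ => (projIcc (0 : ℝ) 1 zero_le_one t : ℝ) :=
    continuous_subtype_val.comp continuous_projIcc
  exact this.mul (continuous_const.sub this)

theorem tent_of_nonpos {t : ℝ} (h : t ≤ 0) : tent t = 0 := by
  rw [tent, projIcc_of_le_left _ h, zero_mul]

theorem tent_of_mem {t : ℝ} (h : t ∈ Icc (0 : ℝ) 1) : tent t = t * (1 - t) := by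
  rw [tent, projIcc_of_mem _ h]

theorem tent_one_sub (t : ℝ) : tent (1 - t) = tent t := by
  have h : (projIcc (0 : ℝ) 1 zero_le_one (1 - t) : ℝ) = 1 - projIcc (0 : ℝ) 1 zero_le_one t := by
    simp only [coe_projIcc]
    rcases le_total t 0 with h0 | h0
    · rw [min_eq_left (by linarith), min_eq_right (by linarith), max_eq_left h0,
        max_eq_right zero_le_one, sub_zero]
    · rcases le_total t 1 with h1 | h1
      · rw [min_eq_right (by linarith), min_eq_right h1, max_eq_right (by linarith),
          max_eq_right h0]
      · rw [min_eq_right (by linarith), min_eq_left h1, max_eq_left (by linarith),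
          max_eq_right zero_le_one, sub_self]
  rw [tent, tent, h]
  ring

variable {m : ℕ} {V : Type} {E : Type*} (C : TubeConfig m V E) (h : V → ℝ)

open Classical in
/-- The end of the edge `e` other than `v`. -/
noncomputable def other (e : E) (v : V) : V := if C.src e = v then C.tgt e else C.src e

theorem other_src (e : E) : C.other e (C.src e) = C.tgt e := if_pos rfl

theorem other_tgt (e : E) : C.other e (C.tgt e) = C.src e := if_neg (C.src_ne_tgt e)

open Classical in
/-- The height function on the pieces. -/
noncomputable def height [Fintype E] (j : V × Bool) (x : EuclideanSpace ℝ (Fin m)) : ℝ :=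
  h j.1 + ∑ e : E, if j.2 = true ∧ C.Inc e j.1 then
    (h (C.other e j.1) - h j.1) * Real.smoothTransition (param (dist x (C.center e))) else 0

open Classical in
/-- Bump functions on the pieces, one for each edge, supported in the tube of the edge. -/
noncomputable def bump (j : V × Bool) (x : EuclideanSpace ℝ (Fin m)) (e : E) : ℝ :=
  if j.2 = true ∧ C.Inc e j.1 then tent (param (dist x (C.center e))) else 0

variable {C} {h}

theorem height_of_far [Fintype E] {j : V × Bool} {x : EuclideanSpace ℝ (Fin m)}
    (hx : j.2 = true → ∀ e, C.Inc e j.1 → Real.exp (1 / 4) ≤ dist x (C.center e)) :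
    C.height h j x = h j.1 := by
  rw [height, Finset.sum_eq_zero, add_zero]
  intro e _
  split_ifs with he
  · have h1 := hx he.1 e he.2
    rw [Real.smoothTransition.zero_of_nonpos
      ((param_le_zero_iff ((Real.exp_pos _).trans_le h1)).2 h1), mul_zero]
  · rfl

theorem bump_of_far {j : V × Bool} {x : EuclideanSpace ℝ (Fin m)}
    (hx : j.2 = true → ∀ e, C.Inc e j.1 → Real.exp (1 / 4) ≤ dist x (C.center e)) :
    C.bump j x = 0 := by
  funext e
  rw [bump]
  split_ifs with he
  · have h1 := hx he.1 e he.2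
    exact tent_of_nonpos ((param_le_zero_iff ((Real.exp_pos _).trans_le h1)).2 h1)
  · rfl

theorem height_of_near [Fintype E] {v : V} {e : E} (he : C.Inc e v)
    {x : EuclideanSpace ℝ (Fin m)} (hx : dist x (C.center e) ≤ 2) :
    C.height h (v, true) x = h v +
      (h (C.other e v) - h v) * Real.smoothTransition (param (dist x (C.center e))) := by
  rw [height, Finset.sum_eq_single e, if_pos ⟨rfl, he⟩]
  · intro e' _ hne
    split_ifs
    · rw [Real.smoothTransition.zero_of_nonpos, mul_zero]
      exact param_le_zero (by linarith [C.center_dist_of_ne hne.symm hx])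
    · rfl
  · exact fun h => absurd (Finset.mem_univ e) h

open Classical in
theorem bump_of_near {v : V} {e : E} (he : C.Inc e v)
    {x : EuclideanSpace ℝ (Fin m)} (hx : dist x (C.center e) ≤ 2) :
    C.bump (v, true) x = Pi.single e (tent (param (dist x (C.center e)))) := by
  funext e'
  by_cases hne : e' = e
  · subst hne
    rw [bump, if_pos ⟨rfl, he⟩, Pi.single_eq_same]
  · rw [bump, Pi.single_eq_of_ne hne]
    split_ifs
    · exact tent_of_nonpos (param_le_zero (by linarith [C.center_dist_of_ne (Ne.symm hne) hx]))
    · rfl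

theorem contDiffAt_height [Fintype E] {j : V × Bool} {x : EuclideanSpace ℝ (Fin m)}
    (hx : x ∈ C.dom j) : ContDiffAt ℝ ∞ (C.height h j) x := by
  refine contDiffAt_const.add (ContDiffAt.sum fun e _ => ?_)
  split_ifs with he
  · have hd : 1 / 2 < dist x (C.center e) := hx.2 he.1 e he.2
    have hd0 : dist x (C.center e) ≠ 0 := by linarith
    refine contDiffAt_const.mul (Real.smoothTransition.contDiffAt.comp x
      (ContDiffAt.comp (g := param) x (contDiffAt_param hd0) ?_))
    exact contDiffAt_id.dist ℝ contDiffAt_const (dist_ne_zero.1 hd0)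
  · exact contDiffAt_const

theorem continuousOn_bump (j : V × Bool) : ContinuousOn (C.bump j) (C.dom j) := by
  refine continuousOn_pi.2 fun e x hx => ContinuousAt.continuousWithinAt ?_
  simp only [bump]
  split_ifs with he
  · have hd : 1 / 2 < dist x (C.center e) := hx.2 he.1 e he.2
    have hd0 : dist x (C.center e) ≠ 0 := by linarith
    refine continuous_tent.continuousAt.comp (ContinuousAt.comp (g := param)
      (contDiffAt_param hd0).continuousAt ?_)
    fun_prop
  · exact continuousAt_const

/-- Along a tube, reversing the parameter compensates for exchanging the two ends, by the symmetry
of `smoothTransition` and `tent`. In the annulus that closes a sphere, both sides are constant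
because all tubes are far away. -/
theorem height_bump_eq_of_links [Fintype E] {l : E ⊕ V} {j k : V × Bool} (hl : C.Links l j k)
    {x y : EuclideanSpace ℝ (Fin m)} (hx : x ∈ C.dom j) (hy : y ∈ C.dom k)
    (hxc : x ≠ C.linkCenter l) (hxy : y = inversion (C.linkCenter l) (C.linkRadius l) x) :
    (C.height h j x, C.bump j x) = (C.height h k y, C.bump k y) := by
  classical
  have hρ := C.linkRadius_pos l
  have hyc : y ≠ C.linkCenter l := by
    rwa [hxy, Ne, EuclideanGeometry.inversion_eq_center hρ.ne']
  have hyx : x = inversion (C.linkCenter l) (C.linkRadius l) y := by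
    rw [hxy, EuclideanGeometry.inversion_inversion _ hρ.ne']
  have a1 := hl.mem_annulus hx hxc (hxy ▸ hy)
  have a2 := hl.symm.mem_annulus hy hyc (hyx ▸ hx)
  have hd := C.dist_inversion (l := l) (x := x)
  rw [← hxy] at hd
  obtain e | v := l
  · obtain ⟨j1, j2⟩ := j
    obtain ⟨k1, k2⟩ := k
    change _ ∧ dist x (C.center e) < 2 * 1 at a1
    change _ ∧ dist y (C.center e) < 2 * 1 at a2
    change dist y (C.center e) = 1 ^ 2 / dist x (C.center e) at hd
    rw [one_pow, one_div] at hd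
    obtain ⟨rfl : j2 = true, rfl : k2 = true, hjk⟩ := hl
    have hj : C.Inc e j1 := hjk.imp And.left And.left
    have hk : C.Inc e k1 := (hjk.imp And.right And.right).symm
    rw [height_of_near hj (by linarith), height_of_near hk (by linarith),
      bump_of_near hj (by linarith), bump_of_near hk (by linarith), hd, param_inv, tent_one_sub,
      Real.smoothTransition_one_sub]
    rcases hjk with ⟨rfl, rfl⟩ | ⟨rfl, rfl⟩ <;> rw [other_src, other_tgt] <;> congr 1 <;> ring
  · change C.radius / 2 < dist x 0 ∧ _ at a1
    change C.radius / 2 < dist y 0 ∧ _ at a2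
    have b1 : ∀ e, Real.exp (1 / 4) ≤ dist x (C.center e) := fun e => by
      linarith [C.dist_center_ge e x, exp_quarter_lt_two]
    have b2 : ∀ e, Real.exp (1 / 4) ≤ dist y (C.center e) := fun e => by
      linarith [C.dist_center_ge e y, exp_quarter_lt_two]
    rw [height_of_far fun _ e _ => b1 e, height_of_far fun _ e _ => b2 e,
      bump_of_far fun _ e _ => b1 e, bump_of_far fun _ e _ => b2 e, hl.1, hl.2.1]

variable [TopologicalSpace V] [DiscreteTopology V] [Finite V] [Fintype E]

variable (C h)

/-- The height and the bump functions on the glued space. -/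
noncomputable def coordMap : C.gluing.Space → ℝ × (E → ℝ) :=
  C.gluing.lift (fun j x => (C.height h j x, C.bump j x)) <| by
    rintro z w (rfl | ⟨l, hl, hz, hw⟩)
    · rfl
    · exact height_bump_eq_of_links hl z.2 w.2 hz hw

theorem coordMap_pt (j : V × Bool) (x : EuclideanSpace ℝ (Fin m)) (hx : x ∈ C.dom j) :
    C.coordMap h (C.gluing.pt j x hx) = (C.height h j x, C.bump j x) := rfl

theorem continuous_coordMap : Continuous (C.coordMap h) :=
  SmoothGluing.continuous_of_forall (F := fun j x => (C.height h j x, C.bump j x))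
    (fun j => ContinuousOn.prodMk
      (fun _ hx => (contDiffAt_height hx).continuousAt.continuousWithinAt) (continuousOn_bump j))
    fun _ _ _ => rfl

variable {C h}

theorem pt_eq_pt_of_links {l : E ⊕ V} {j k : V × Bool} (hl : C.Links l j k)
    {x : EuclideanSpace ℝ (Fin m)} (hx : x ∈ C.dom j)
    (h1 : C.linkRadius l / 2 < dist x (C.linkCenter l))
    (h2 : dist x (C.linkCenter l) < 2 * C.linkRadius l) :
    C.gluing.pt j x hx = C.gluing.pt k _ (hl.inversion_mem h1 h2) := by
  refine C.gluing.pt_eq_pt.2 (.inr ⟨l, hl, dist_pos.1 ?_, rfl⟩)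
  linarith [C.linkRadius_pos l]

variable (C)

/-- The part of the first piece of a vertex which lies outside all tubes. -/
def core (v : V) (r : ℝ) : Set (EuclideanSpace ℝ (Fin m)) :=
  {x | dist x 0 ≤ C.radius ∧ ∀ e, C.Inc e v → r ≤ dist x (C.center e)}

omit [TopologicalSpace V] [DiscreteTopology V] [Finite V] [Fintype E] in
theorem core_subset (v : V) {r : ℝ} (hr : 1 / 2 < r) : C.core v r ⊆ C.dom (v, true) :=
  fun _ hx => ⟨by linarith [hx.1, C.radius_pos], fun _ e he => hr.trans_le (hx.2 e he)⟩

omit [TopologicalSpace V] [DiscreteTopology V] [Finite V] [Fintype E] in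
theorem closedBall_subset (v : V) : Metric.closedBall 0 C.radius ⊆ C.dom (v, false) :=
  fun x hx => ⟨by linarith [Metric.mem_closedBall.1 hx, C.radius_pos], fun h => by cases h⟩

/-- Every point of the glued space has a representative in a compact part of some piece. -/
theorem exists_mem_core_or (z : C.gluing.Space) :
    ∃ v, (∃ x, ∃ hx : x ∈ C.dom (v, true), x ∈ C.core v 1 ∧ C.gluing.pt _ x hx = z) ∨
      ∃ x, ∃ hx : x ∈ C.dom (v, false), x ∈ Metric.closedBall 0 C.radius ∧
        C.gluing.pt _ x hx = z := by
  have hR := C.radius_pos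
  obtain ⟨⟨v, b⟩, x, hx : x ∈ C.dom (v, b), rfl⟩ := C.gluing.exists_eq_pt z
  by_cases hxR : dist x 0 ≤ C.radius
  · cases b
    · exact ⟨v, .inr ⟨x, hx, hxR, rfl⟩⟩
    · by_cases hxe : ∀ e, C.Inc e v → 1 ≤ dist x (C.center e)
      · exact ⟨v, .inl ⟨x, hx, ⟨hxR, hxe⟩, rfl⟩⟩
      -- A point inside the unit sphere about the centre of a tube is past the middle of that tube;
      -- inversion represents it in the piece of the other end.
      push Not at hxe
      obtain ⟨e, he, hd⟩ := hxe
      have hd' : 1 / 2 < dist x (C.center e) := hx.2 rfl e he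
      obtain ⟨w, hw, hl⟩ : ∃ w, C.Inc e w ∧ C.Links (.inl e) (v, true) (w, true) := by
        rcases he with he | he
        · exact ⟨_, C.inc_tgt e, rfl, rfl, .inl ⟨he, rfl⟩⟩
        · exact ⟨_, C.inc_src e, rfl, rfl, .inr ⟨he, rfl⟩⟩
      have h2 : dist x (C.linkCenter (.inl e)) < 2 * C.linkRadius (.inl e) := by
        change dist x (C.center e) < 2 * 1
        linarith
      refine ⟨w, .inl ⟨_, hl.inversion_mem hd' h2, ?_, (pt_eq_pt_of_links hl hx hd' h2).symm⟩⟩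
      have hy := C.dist_inversion (l := .inl e) (x := x)
      set y := inversion (C.linkCenter (.inl e)) (C.linkRadius (.inl e)) x
      change dist y (C.center e) = 1 ^ 2 / dist x (C.center e) at hy
      have hd0 : 0 < dist x (C.center e) := by linarith
      have hy1 : 1 ≤ dist y (C.center e) := by
        rw [hy, le_div_iff₀ hd0]
        linarith
      have hy2 : dist y (C.center e) ≤ 2 := by
        rw [hy, div_le_iff₀ hd0]
        linarith
      refine ⟨by linarith [C.dist_zero_le hy2], fun e' _ => ?_⟩
      by_cases hee : e = e'
      · subst hee
        exact hy1
      · linarith [C.center_dist_of_ne hee hy2]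
  -- A point outside the sphere of radius $R$ is moved by inversion to the other ball of the same
  -- vertex.
  · push Not at hxR
    have hl : C.Links (.inr v) (v, b) (v, !b) := ⟨rfl, rfl, by cases b <;> simp⟩
    have h1 : C.linkRadius (.inr v) / 2 < dist x (C.linkCenter (.inr v)) := by
      change C.radius / 2 < dist x 0
      linarith
    have hy := C.dist_inversion (l := .inr v) (x := x)
    have hp := pt_eq_pt_of_links hl hx h1 hx.1
    have hym := hl.inversion_mem h1 hx.1
    set y := inversion (C.linkCenter (.inr v)) (C.linkRadius (.inr v)) x
    change dist y 0 = C.radius ^ 2 / dist x 0 at hy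
    have hd0 : 0 < dist x 0 := by linarith
    have hy1 : dist y 0 ≤ C.radius := by
      rw [hy, div_le_iff₀ hd0]
      nlinarith
    have hy2 : C.radius / 2 < dist y 0 := by
      have : dist x 0 < 2 * C.radius := hx.1
      rw [hy, lt_div_iff₀ hd0]
      nlinarith
    cases b
    · exact ⟨v, .inl ⟨y, hym, ⟨hy1, fun e _ => by linarith [C.dist_center_ge e y]⟩, hp.symm⟩⟩
    · exact ⟨v, .inr ⟨y, hym, hy1, hp.symm⟩⟩

omit [TopologicalSpace V] [DiscreteTopology V] [Finite V] [Fintype E] in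
theorem isCompact_core (v : V) (r : ℝ) : IsCompact (C.core v r) := by
  refine (isCompact_closedBall (0 : EuclideanSpace ℝ (Fin m)) C.radius).of_isClosed_subset ?_
    fun x hx => hx.1
  have key : C.core v r = Metric.closedBall 0 C.radius ∩
      ⋂ e : {e : E // C.Inc e v}, {x | r ≤ dist x (C.center e)} := by
    ext x
    simp [core]
  rw [key]
  exact Metric.isClosed_closedBall.inter (isClosed_iInter fun e =>
    isClosed_le continuous_const (continuous_id.dist continuous_const))

instance : CompactSpace C.gluing.Space := by
  refine ⟨?_⟩
  have h1 : IsCompact (⋃ v : V,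
      {z | ∃ x, ∃ hx : x ∈ C.dom (v, true), x ∈ C.core v 1 ∧ C.gluing.pt _ x hx = z} ∪
      {z | ∃ x, ∃ hx : x ∈ C.dom (v, false), x ∈ Metric.closedBall 0 C.radius ∧
        C.gluing.pt _ x hx = z}) :=
    isCompact_iUnion fun v =>
      (C.gluing.isCompact_image_pt (j := (v, true)) (C.isCompact_core v 1)
        (C.core_subset v (by norm_num))).union
      (C.gluing.isCompact_image_pt (j := (v, false)) (isCompact_closedBall _ _)
        (C.closedBall_subset v))
  convert h1
  rw [eq_comm, eq_univ_iff_forall]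
  intro z
  obtain ⟨v, hv⟩ := C.exists_mem_core_or z
  exact mem_iUnion.2 ⟨v, hv⟩

/-- The part of the glued space that belongs to a vertex. -/
def vertexPart (v : V) : Set C.gluing.Space :=
  {z | ∃ x, ∃ hx : x ∈ C.dom (v, true),
    x ∈ C.core v (Real.exp (1 / 4)) ∧ C.gluing.pt _ x hx = z} ∪
  {z | ∃ x, ∃ hx : x ∈ C.dom (v, false), x ∈ Metric.closedBall 0 C.radius ∧
    C.gluing.pt _ x hx = z}

/-- Vertex parts and open tubes cover the manifold. A tube point seen from the target end is
inverted, so that only the chart of the source end is needed. -/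
theorem mem_vertexPart_or (z : C.gluing.Space) :
    (∃ v, z ∈ C.vertexPart v) ∨ ∃ e x, ∃ hx : x ∈ C.dom (C.src e, true),
      Real.exp (-(1 / 4)) < dist x (C.center e) ∧ dist x (C.center e) < Real.exp (1 / 4) ∧
      C.gluing.pt _ x hx = z := by
  obtain ⟨v, ⟨x, hx, hxc, rfl⟩ | h⟩ := C.exists_mem_core_or z
  · by_cases hxe : ∀ e, C.Inc e v → Real.exp (1 / 4) ≤ dist x (C.center e)
    · exact .inl ⟨v, .inl ⟨x, hx, ⟨hxc.1, hxe⟩, rfl⟩⟩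
    push Not at hxe
    obtain ⟨e, he, hd⟩ := hxe
    have h1 : Real.exp (-(1 / 4)) < dist x (C.center e) :=
      (Real.exp_lt_one_iff.2 (by norm_num)).trans_le (hxc.2 e he)
    refine .inr ⟨e, ?_⟩
    rcases he with rfl | rfl
    · exact ⟨x, hx, h1, hd, rfl⟩
    have hl : C.Links (.inl e) (C.tgt e, true) (C.src e, true) := ⟨rfl, rfl, .inr ⟨rfl, rfl⟩⟩
    have h3 : C.linkRadius (.inl e) / 2 < dist x (C.linkCenter (.inl e)) :=
      half_lt_exp_neg_quarter.trans h1
    have h4 : dist x (C.linkCenter (.inl e)) < 2 * C.linkRadius (.inl e) := by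
      change dist x (C.center e) < 2 * 1
      linarith [exp_quarter_lt_two]
    refine ⟨_, hl.inversion_mem h3 h4, ?_, ?_, (pt_eq_pt_of_links hl hx h3 h4).symm⟩
    · have hy := C.dist_inversion (l := .inl e) (x := x)
      change dist _ (C.center e) = 1 ^ 2 / dist x (C.center e) at hy
      rw [hy, one_pow, one_div (dist _ _), Real.exp_neg]
      exact inv_strictAnti₀ ((Real.exp_pos _).trans h1) hd
    · have hy := C.dist_inversion (l := .inl e) (x := x)
      change dist _ (C.center e) = 1 ^ 2 / dist x (C.center e) at hy
      rw [hy, one_pow, one_div (dist _ _), inv_lt_comm₀ ((Real.exp_pos _).trans h1) (Real.exp_pos _),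
        ← Real.exp_neg]
      exact h1
  · exact .inl ⟨v, .inr h⟩

variable {C}

theorem coordMap_of_mem_vertexPart {v : V} {z : C.gluing.Space} (hz : z ∈ C.vertexPart v) :
    C.coordMap h z = (h v, 0) := by
  rcases hz with ⟨x, hx, hxc, rfl⟩ | ⟨x, hx, -, rfl⟩
  · rw [coordMap_pt, height_of_far fun _ => hxc.2, bump_of_far fun _ => hxc.2]
  · rw [coordMap_pt, height_of_far fun h' => (Bool.false_ne_true h').elim,
      bump_of_far fun h' => (Bool.false_ne_true h').elim]

open Classical in
theorem coordMap_of_tube {e : E} {x : EuclideanSpace ℝ (Fin m)} (hx : x ∈ C.dom (C.src e, true))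
    (h2 : dist x (C.center e) < Real.exp (1 / 4)) :
    C.coordMap h (C.gluing.pt _ x hx) =
      (h (C.src e) + (h (C.tgt e) - h (C.src e)) *
        Real.smoothTransition (param (dist x (C.center e))),
      Pi.single e (tent (param (dist x (C.center e))))) := by
  have h3 : dist x (C.center e) ≤ 2 := (h2.trans exp_quarter_lt_two).le
  rw [coordMap_pt, height_of_near (C.inc_src e) h3, bump_of_near (C.inc_src e) h3, other_src]

end TubeConfig

/-! ### Connected fibres, noncritical tubes and existence of a configuration -/

namespace TubeConfig

variable {m : ℕ} {V : Type} {E : Type*} (C : TubeConfig m V E)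

theorem one_lt_rank_euclideanSpace (hm : 2 ≤ m) :
    1 < Module.rank ℝ (EuclideanSpace ℝ (Fin m)) := by
  rw [← Module.finrank_eq_rank, finrank_euclideanSpace_fin]
  exact_mod_cast hm

open Classical in
/-- The map that pushes the balls of radius `r` around the places where the tubes of a vertex are
attached radially onto their boundaries. -/
noncomputable def push [Fintype E] (v : V) (r : ℝ) (x : EuclideanSpace ℝ (Fin m)) :
    EuclideanSpace ℝ (Fin m) :=
  x + ∑ e : E, if C.Inc e v then
    (max 0 (r - dist x (C.center e)) / dist x (C.center e)) • (x - C.center e) else 0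

theorem continuousOn_push [Fintype E] (v : V) (r : ℝ) :
    ContinuousOn (C.push v r) (C.center '' {e | C.Inc e v})ᶜ := by
  refine continuousOn_id.add (continuousOn_finsetSum _ fun e _ => ?_)
  split_ifs with he
  · have hd : Continuous fun x : EuclideanSpace ℝ (Fin m) => dist x (C.center e) := by fun_prop
    have hs : Continuous fun x : EuclideanSpace ℝ (Fin m) => x - C.center e := by fun_prop
    refine ((continuous_const.max (continuous_const.sub hd)).continuousOn.div
      hd.continuousOn ?_).smul hs.continuousOn
    rintro x hx h0
    exact hx ⟨e, he, (dist_eq_zero.1 h0).symm⟩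
  · exact continuousOn_const

variable {C}

theorem push_of_far [Fintype E] {v : V} {r : ℝ} {x : EuclideanSpace ℝ (Fin m)}
    (hx : ∀ e, C.Inc e v → r ≤ dist x (C.center e)) : C.push v r x = x := by
  rw [push, Finset.sum_eq_zero, add_zero]
  intro e _
  split_ifs with he
  · rw [max_eq_left (sub_nonpos.2 (hx e he)), zero_div, zero_smul]
  · rfl

theorem push_far [Fintype E] {v : V} {r : ℝ} (hr0 : 0 < r) (hr : r ≤ 2)
    {x : EuclideanSpace ℝ (Fin m)} (hx : x ∉ C.center '' {e | C.Inc e v}) (e : E)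
    (he : C.Inc e v) : r ≤ dist (C.push v r x) (C.center e) := by
  by_cases hfar : ∀ e, C.Inc e v → r ≤ dist x (C.center e)
  · rw [push_of_far hfar]
    exact hfar e he
  push Not at hfar
  obtain ⟨i, hi, hd⟩ := hfar
  have hd0 : 0 < dist x (C.center i) := dist_pos.2 fun h => hx ⟨i, hi, h.symm⟩
  have h1 : C.push v r x =
      x + ((r - dist x (C.center i)) / dist x (C.center i)) • (x - C.center i) := by
    rw [push, Finset.sum_eq_single i, if_pos hi, max_eq_right (by linarith)]
    · intro j _ hj
      split_ifs
      · rw [max_eq_left, zero_div, zero_smul]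
        linarith [C.center_dist_of_ne hj.symm hd.le]
      · rfl
    · exact fun h => absurd (Finset.mem_univ i) h
  have h2 : C.push v r x - C.center i = (r / dist x (C.center i)) • (x - C.center i) := by
    nth_rewrite 1 [h1, add_sub_right_comm, ← one_smul ℝ (x - C.center i)]
    rw [← add_smul]
    congr 1
    field_simp
    ring
  have h3 : dist (C.push v r x) (C.center i) = r := by
    rw [dist_eq_norm, h2, norm_smul, ← dist_eq_norm, Real.norm_of_nonneg (by positivity),
      div_mul_cancel₀ _ hd0.ne']
  by_cases hei : i = e
  · rw [← hei, h3]
  · linarith [C.center_dist_of_ne hei h3.le]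

/-- The holed ball is a retract of $\mathbb{R}^m$ minus the finitely many centres, which is
connected as $m \ge 2$: push points out of the holes radially, then clamp to the ball of radius $R$.
-/
theorem isPreconnected_core (hm : 2 ≤ m) [Fintype E] (v : V) {r : ℝ} (hr0 : 0 < r) (hr : r ≤ 2) :
    IsPreconnected (C.core v r) := by
  have hR := C.radius_pos
  have hP : IsPreconnected (C.center '' {e | C.Inc e v})ᶜ :=
    ((toFinite _).countable.isConnected_compl_of_one_lt_rank
      (one_lt_rank_euclideanSpace hm)).isPreconnected
  let clamp (y : EuclideanSpace ℝ (Fin m)) : EuclideanSpace ℝ (Fin m) :=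
    (C.radius / max C.radius ‖y‖) • y
  have hclamp : Continuous clamp := by
    refine (continuous_const.div (continuous_const.max continuous_norm) fun y => ?_).smul continuous_id
    exact (hR.trans_le (le_max_left _ _)).ne'
  have hid : ∀ y, ‖y‖ ≤ C.radius → clamp y = y := fun y hy => by
    simp only [clamp]
    rw [max_eq_left hy, div_self hR.ne', one_smul]
  convert (hP.image _ (C.continuousOn_push v r)).image clamp hclamp.continuousOn
  ext y
  constructor
  · intro hy
    refine ⟨y, ⟨y, ?_, push_of_far hy.2⟩, hid y (by simpa using hy.1)⟩
    rintro ⟨e, he, rfl⟩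
    have := hy.2 e he
    rw [dist_self] at this
    linarith
  · rintro ⟨_, ⟨x, hx, rfl⟩, rfl⟩
    have h1 := push_far hr0 hr hx
    set y := C.push v r x
    rcases le_total ‖y‖ C.radius with hy | hy
    · rw [hid y hy]
      exact ⟨by simpa using hy, h1⟩
    · have h2 : dist (clamp y) 0 = C.radius := by
        have hy0 : 0 < ‖y‖ := hR.trans_le hy
        simp only [clamp]
        rw [max_eq_right hy, dist_zero_right, norm_smul, Real.norm_of_nonneg (by positivity),
          div_mul_cancel₀ _ hy0.ne']
      -- A clamped point lies on the sphere of radius $R$, while the holes stay within $R/2$, so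
      -- clamping does not push it back into a hole.
      exact ⟨h2.le, fun e _ => by linarith [C.dist_center_ge e (clamp y)]⟩

variable (C) in
theorem sphere_subset_dom {e : E} {r : ℝ} (h1 : 1 / 2 < r) (h2 : r ≤ 2) :
    Metric.sphere (C.center e) r ⊆ C.dom (C.src e, true) := by
  intro x hx
  rw [Metric.mem_sphere] at hx
  refine ⟨by linarith [C.radius_pos, C.dist_zero_le hx.le], fun _ e' _ => ?_⟩
  by_cases he : e = e'
  · subst he
    rwa [hx]
  · linarith [C.center_dist_of_ne he hx.le]

/-- The derivative along the ray from the centre is nonzero: along $t \mapsto c + t(x-c)$ the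
parameter has derivative $-2$ at $t = 1$, the step function has positive derivative there, and the
end heights differ. -/
theorem fderiv_height_ne_zero [Fintype E] {h : V → ℝ} (hinj : Function.Injective h) {e : E}
    {x : EuclideanSpace ℝ (Fin m)} (hx : x ∈ C.dom (C.src e, true))
    (h1 : Real.exp (-(1 / 4)) < dist x (C.center e))
    (h2 : dist x (C.center e) < Real.exp (1 / 4)) :
    fderiv ℝ (C.height h (C.src e, true)) x ≠ 0 := by
  intro h0
  set d := dist x (C.center e) with hd
  have hd0 : 0 < d := (Real.exp_pos _).trans h1
  let γ : ℝ → EuclideanSpace ℝ (Fin m) := fun t => C.center e + t • (x - C.center e)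
  have hγ1 : γ 1 = x := by simp [γ]
  have hγ : HasDerivAt γ (x - C.center e) 1 := by
    have := ((hasDerivAt_id (1 : ℝ)).smul_const (x - C.center e)).const_add (C.center e)
    rwa [one_smul] at this
  have hF : HasFDerivAt (C.height h (C.src e, true))
      (0 : EuclideanSpace ℝ (Fin m) →L[ℝ] ℝ) (γ 1) := by
    rw [hγ1, ← h0]
    exact ((contDiffAt_height hx).differentiableAt (by simp)).hasFDerivAt
  have hA : HasDerivAt (fun t => C.height h (C.src e, true) (γ t)) 0 1 := by
    exact hF.comp_hasDerivAt (1 : ℝ) hγ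
  obtain ⟨c, hc, hS⟩ := Real.exists_hasDerivAt_smoothTransition
    (not_le.1 (mt (param_le_zero_iff hd0).1 (not_le.2 h2))) ((param_lt_one_iff hd0).2 h1)
  have hp : HasDerivAt (fun t : ℝ => param (t * d)) (-2) 1 := by
    have b1 : HasDerivAt (fun t : ℝ => Real.log (t * d)) (d / (1 * d)) 1 := by
      simpa using ((hasDerivAt_id (1 : ℝ)).mul_const d).log (by simpa using hd0.ne')
    have b2 := (b1.const_mul 2).const_sub (1 / 2)
    have b3 : -(2 * (d / (1 * d))) = -2 := by
      rw [one_mul, div_self hd0.ne', mul_one]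
    rwa [b3] at b2
  have hS' : HasDerivAt Real.smoothTransition c (param (1 * d)) := by rwa [one_mul]
  have hB := ((hS'.comp (1 : ℝ) hp).const_mul (h (C.tgt e) - h (C.src e))).const_add (h (C.src e))
  have hγd : ∀ t, 0 < t → dist (γ t) (C.center e) = t * d := fun t ht => by
    simp only [γ]
    rw [dist_eq_norm, add_sub_cancel_left, norm_smul, Real.norm_of_nonneg ht.le, hd, dist_eq_norm]
  have hev : (fun t => C.height h (C.src e, true) (γ t)) =ᶠ[𝓝 1]
      fun t => h (C.src e) + (h (C.tgt e) - h (C.src e)) *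
        (Real.smoothTransition ∘ fun t : ℝ => param (t * d)) t := by
    have c1 : ∀ᶠ t : ℝ in 𝓝 1, t * d < 2 :=
      (continuous_id.mul continuous_const).continuousAt.eventually_lt_const
        (by simpa using h2.trans exp_quarter_lt_two)
    filter_upwards [c1, lt_mem_nhds one_pos] with t ht1 ht0
    rw [height_of_near (C.inc_src e) (by rw [hγd t ht0]; exact ht1.le), hγd t ht0, other_src]
    rfl
  have huniq := hA.unique (hB.congr_of_eventuallyEq hev)
  have hne : h (C.tgt e) - h (C.src e) ≠ 0 :=
    sub_ne_zero.2 fun hh => C.src_ne_tgt e (hinj hh).symm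
  exact (mul_ne_zero hne (mul_ne_zero hc.ne' (by norm_num))) huniq.symm

/-- The centres are put on a coordinate axis at distance 5 from each other, inside a sufficiently
large ball. -/
theorem exists_of_ends (hm : 0 < m) [Finite E] (src tgt : E → V) (hne : ∀ e, src e ≠ tgt e) :
    ∃ C : TubeConfig m V E, C.src = src ∧ C.tgt = tgt := by
  obtain ⟨k, ⟨i⟩⟩ := Finite.exists_equiv_fin E
  have hd : ∀ a b : ℝ, dist (EuclideanSpace.single (⟨0, hm⟩ : Fin m) a)
      (EuclideanSpace.single (⟨0, hm⟩ : Fin m) b) = |a - b| := fun a b => by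
    rw [PiLp.dist_single_same, Real.dist_eq]
  refine ⟨⟨src, tgt, hne, fun e => EuclideanSpace.single ⟨0, hm⟩ (5 * (i e : ℕ) : ℝ),
    10 * k + 10, by positivity, fun e e' hee => ?_, fun e => ?_⟩, rfl, rfl⟩
  · rw [hd, ← mul_sub, abs_mul, abs_of_pos (by norm_num : (0 : ℝ) < 5)]
    have h1 : ((i e : ℕ) : ℤ) - (i e' : ℕ) ≠ 0 := by
      exact sub_ne_zero.2 fun h => hee (i.injective (Fin.ext (Int.ofNat_inj.1 h)))
    have h2 : (1 : ℝ) ≤ |((i e : ℕ) : ℝ) - (i e' : ℕ)| := by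
      exact_mod_cast Int.one_le_abs h1
    linarith
  · have h1 : ((i e : ℕ) : ℝ) ≤ k := by exact_mod_cast (i e).2.le
    rw [dist_zero_right, PiLp.norm_single, Real.norm_of_nonneg (by positivity)]
    linarith

variable [TopologicalSpace V] [DiscreteTopology V] [Finite V] [Fintype E]

/-- The holed ball and the closed ball are connected and meet, since the inversion that glues them
fixes the sphere of radius $R$ pointwise. -/
theorem isPreconnected_vertexPart (hm : 2 ≤ m) (v : V) : IsPreconnected (C.vertexPart v) := by
  have : Nontrivial (EuclideanSpace ℝ (Fin m)) :=
    rank_pos_iff_nontrivial.1 (zero_lt_one.trans (one_lt_rank_euclideanSpace hm))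
  have hR := C.radius_pos
  obtain ⟨x, hx⟩ := NormedSpace.sphere_nonempty (x := (0 : EuclideanSpace ℝ (Fin m))).2 hR.le
  have hxR : dist x 0 = C.radius := hx
  have hxc : x ∈ C.core v (Real.exp (1 / 4)) :=
    ⟨hxR.le, fun e _ => by linarith [C.dist_center_ge e x, exp_quarter_lt_two]⟩
  have hsub := C.core_subset v (r := Real.exp (1 / 4)) (by linarith [one_lt_exp_quarter])
  have hl : C.Links (.inr v) (v, true) (v, false) := ⟨rfl, rfl, by simp⟩
  have h1 : C.linkRadius (.inr v) / 2 < dist x (C.linkCenter (.inr v)) := by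
    change C.radius / 2 < dist x 0
    linarith
  have h2 : dist x (C.linkCenter (.inr v)) < 2 * C.linkRadius (.inr v) := by
    change dist x 0 < 2 * C.radius
    linarith
  refine IsPreconnected.union (C.gluing.pt (v, true) x (hsub hxc)) ⟨x, hsub hxc, hxc, rfl⟩ ?_
    (C.gluing.isPreconnected_image_pt (j := (v, true))
      (isPreconnected_core hm v (Real.exp_pos _) exp_quarter_lt_two.le) hsub)
    (C.gluing.isPreconnected_image_pt (j := (v, false))
      (convex_closedBall _ _).isPreconnected (C.closedBall_subset v))
  refine ⟨_, hl.inversion_mem h1 h2, ?_, (pt_eq_pt_of_links hl (hsub hxc) h1 h2).symm⟩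
  have h3 : inversion (C.linkCenter (.inr v)) (C.linkRadius (.inr v)) x = x :=
    EuclideanGeometry.inversion_of_mem_sphere hx
  rw [h3]
  exact Metric.sphere_subset_closedBall hx

theorem isPreconnected_tube_slice (hm : 2 ≤ m) (e : E) {r : ℝ} (h1 : 1 / 2 < r) (h2 : r ≤ 2) :
    IsPreconnected {z | ∃ x, ∃ hx : x ∈ C.dom (C.src e, true),
      x ∈ Metric.sphere (C.center e) r ∧ C.gluing.pt _ x hx = z} :=
  C.gluing.isPreconnected_image_pt (j := (C.src e, true))
    (isPreconnected_sphere (one_lt_rank_euclideanSpace hm) _ _) (C.sphere_subset_dom h1 h2)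

end TubeConfig

/-! ### Collapsing the manifold onto the graph -/

open scoped Graph

namespace TubeConfig

variable {α β : Type*} {G : Graph α β} {m : ℕ} {V : Type} [TopologicalSpace V]
  [DiscreteTopology V] [Finite V] [Fintype E(G)] {C : TubeConfig m V E(G)} {eV : V(G) ≃ V}
  {h : V → ℝ}

theorem coords_vertexPoint_eq {v : V(G)} {z : C.gluing.Space} (hz : z ∈ C.vertexPart (eV v)) :
    G.coords (h ∘ eV) (G.vertexPoint v) = C.coordMap h z := by
  rw [coordMap_of_mem_vertexPart hz]
  rfl

theorem param_mem_Ioo {d : ℝ} (h1 : Real.exp (-(1 / 4)) < d) (h2 : d < Real.exp (1 / 4)) :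
    param d ∈ Ioo (0 : ℝ) 1 := by
  have hd : 0 < d := (Real.exp_pos _).trans h1
  exact ⟨not_le.1 (mt (param_le_zero_iff hd).1 (not_le.2 h2)), (param_lt_one_iff hd).2 h1⟩

theorem coords_edgePoint_eq (hsrc : ∀ e, C.src e = eV (G.edgeEnds e).1)
    (htgt : ∀ e, C.tgt e = eV (G.edgeEnds e).2) {e : E(G)} {x : EuclideanSpace ℝ (Fin m)}
    (hx : x ∈ C.dom (C.src e, true)) (h1 : Real.exp (-(1 / 4)) < dist x (C.center e))
    (h2 : dist x (C.center e) < Real.exp (1 / 4)) :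
    G.coords (h ∘ eV) (G.edgePoint e ⟨param (dist x (C.center e)),
      Ioo_subset_Icc_self (param_mem_Ioo h1 h2)⟩) = C.coordMap h (C.gluing.pt _ x hx) := by
  rw [coordMap_of_tube hx h2, tent_of_mem (Ioo_subset_Icc_self (param_mem_Ioo h1 h2)), hsrc, htgt,
    Graph.coords_edgePoint]
  congr!

/-- The glued space maps to the graph, with the prescribed values on the vertex parts and on the
tubes. -/
theorem exists_collapse [G.Loopless] [Finite V(G)] (hinj : Function.Injective h)
    (hsrc : ∀ e, C.src e = eV (G.edgeEnds e).1) (htgt : ∀ e, C.tgt e = eV (G.edgeEnds e).2) :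
    ∃ c : C.gluing.Space → G.Realization, Continuous c ∧
      (∀ z, G.coords (h ∘ eV) (c z) = C.coordMap h z) ∧
      (∀ v, ∀ z ∈ C.vertexPart (eV v), c z = G.vertexPoint v) ∧
      ∀ e x (hx : x ∈ C.dom (C.src e, true)) (h1 : Real.exp (-(1 / 4)) < dist x (C.center e))
        (h2 : dist x (C.center e) < Real.exp (1 / 4)), c (C.gluing.pt _ x hx) =
          G.edgePoint e ⟨param (dist x (C.center e)),
            Ioo_subset_Icc_self (param_mem_Ioo h1 h2)⟩ := by
  have hi := Graph.coords_injective (G := G) (hinj.comp eV.injective)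
  -- The coordinates of each point of the manifold lie in the image of the embedded graph; the
  -- collapse is then forced by injectivity.
  have hex : ∀ z, ∃ y, G.coords (h ∘ eV) y = C.coordMap h z := by
    intro z
    rcases C.mem_vertexPart_or z with ⟨v, hv⟩ | ⟨e, x, hx, h1, h2, rfl⟩
    · refine ⟨G.vertexPoint (eV.symm v), coords_vertexPoint_eq ?_⟩
      rwa [eV.apply_symm_apply]
    · exact ⟨_, coords_edgePoint_eq hsrc htgt hx h1 h2⟩
  choose c hc using hex
  refine ⟨c, ?_, hc, fun v z hz => hi ?_, fun e x hx h1 h2 => hi ?_⟩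
  · rw [(Graph.isEmbedding_coords (hinj.comp eV.injective)).continuous_iff]
    convert C.continuous_coordMap h using 1
    exact funext hc
  · rw [hc, coords_vertexPoint_eq hz]
  · rw [hc, coords_edgePoint_eq hsrc htgt hx h1 h2]

end TubeConfig

/-! ### The main theorem -/

open TubeConfig

theorem corollary5p5 (m : ℕ) (hm : 2 ≤ m) {α β : Type*} (G : Graph α β)
    (hV : G.vertexSet.Finite) (hE : G.edgeSet.Finite) (hG : G.Loopless) :
    ∃ (M : Type) (_ : TopologicalSpace M) (_ : ChartedSpace (EuclideanSpace ℝ (Fin m)) M),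
      T2Space M ∧ SecondCountableTopology M ∧ CompactSpace M ∧ IsManifold (𝓡 m) ∞ M ∧
      ∃ f : M → ℝ, ContMDiff (𝓡 m) 𝓘(ℝ, ℝ) ∞ f ∧
        (f '' criticalPoints m f).Finite ∧
        ∃ φ : G.Realization ≃ₜ ReebSpace f,
          φ '' Set.range G.vertexPoint = reebProj f '' criticalPoints m f := by
  classical
  have : Finite V(G) := hV
  have : Finite E(G) := hE
  have := Fintype.ofFinite E(G)
  -- Relabelling the vertices by `Fin n` places the glued manifold in `Type` whatever the universe
  -- of the graph, and provides distinct heights.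
  obtain ⟨n, ⟨eV⟩⟩ := Finite.exists_equiv_fin V(G)
  obtain ⟨C, hsrc, htgt⟩ := exists_of_ends (m := m) (by omega)
    (fun e => eV (G.edgeEnds e).1) (fun e => eV (G.edgeEnds e).2)
    fun e he => G.edgeEnds_ne e (eV.injective he)
  replace hsrc := congrFun hsrc
  replace htgt := congrFun htgt
  let h : Fin n → ℝ := fun i => (i : ℕ)
  have hinj : Function.Injective h := fun i j hij => Fin.ext (Nat.cast_injective hij)
  obtain ⟨c, hcont, hc, hcv, hce⟩ := exists_collapse (eV := eV) hinj hsrc htgt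
  -- The origin of the second ball of each vertex, which no tube touches; it serves below as a
  -- critical point over the vertex.
  have hcv0 : ∀ v, ∃ z ∈ C.vertexPart (eV v), ∃ hx, z = C.gluing.pt (eV v, false) 0 hx := fun v =>
    have h0 := Metric.mem_closedBall_self (x := (0 : EuclideanSpace ℝ (Fin m))) C.radius_pos.le
    ⟨_, .inr ⟨0, C.closedBall_subset _ h0, h0, rfl⟩, _, rfl⟩
  have hd : ∀ {t d : ℝ}, 0 < d → (param d = t ↔ d = Real.exp ((1 / 2 - t) / 2)) := by
    intro t d hd
    rw [param, ← Real.log_injOn_pos.eq_iff hd (Real.exp_pos _), Real.log_exp]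
    constructor <;> intro <;> linarith
  have hexp : ∀ {t : ℝ}, 0 < t → t < 1 →
      Real.exp (-(1 / 4)) < Real.exp ((1 / 2 - t) / 2) ∧
        Real.exp ((1 / 2 - t) / 2) < Real.exp (1 / 4) := fun h0 h1 =>
    ⟨Real.exp_lt_exp.2 (by linarith), Real.exp_lt_exp.2 (by linarith)⟩
  have hslice : ∀ (e : E(G)) (t : unitInterval), 0 < (t : ℝ) → (t : ℝ) < 1 →
      ∀ x (hx : x ∈ C.dom (C.src e, true)), dist x (C.center e) = Real.exp ((1 / 2 - t) / 2) →
        c (C.gluing.pt _ x hx) = G.edgePoint e t := by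
    intro e t h0 h1 x hx hxd
    rw [hce e x hx (hxd ▸ (hexp h0 h1).1) (hxd ▸ (hexp h0 h1).2)]
    congr
    exact (hd (hxd ▸ Real.exp_pos _)).2 hxd
  have : Nontrivial (EuclideanSpace ℝ (Fin m)) :=
    rank_pos_iff_nontrivial.1 (zero_lt_one.trans (one_lt_rank_euclideanSpace hm))
  have hsub : ∀ {t : ℝ}, 0 < t → t < 1 →
      1 / 2 < Real.exp ((1 / 2 - t) / 2) ∧ Real.exp ((1 / 2 - t) / 2) ≤ 2 := fun h0 h1 =>
    ⟨half_lt_exp_neg_quarter.trans (hexp h0 h1).1, ((hexp h0 h1).2.trans exp_quarter_lt_two).le⟩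
  have hsurj : Function.Surjective c := by
    intro y
    rcases G.exists_eq_vertexPoint_or_edgePoint y with ⟨v, rfl⟩ | ⟨e, t, h0, h1, rfl⟩
    · obtain ⟨z, hz, -⟩ := hcv0 v
      exact ⟨z, hcv v z hz⟩
    · obtain ⟨x, hx⟩ := NormedSpace.sphere_nonempty (x := C.center e).2
        (Real.exp_pos ((1 / 2 - t) / 2)).le
      have hxd := C.sphere_subset_dom (hsub h0 h1).1 (hsub h0 h1).2 hx
      exact ⟨_, hslice e t h0 h1 x hxd hx⟩
  have hvne : ∀ (v : V(G)) (e : E(G)) (t : unitInterval), 0 < (t : ℝ) → (t : ℝ) < 1 →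
      G.vertexPoint v ≠ G.edgePoint e t := by
    intro v e t h0 h1 hve
    -- Only the bump coordinates matter here, so the zero height suffices.
    have := congrFun (congrArg Prod.snd (congrArg (G.coords fun _ => 0) hve)) e
    rw [Graph.coords_edgePoint, Graph.coords_vertexPoint] at this
    simp only [Pi.zero_apply, Pi.single_eq_same] at this
    exact (mul_pos h0 (sub_pos.2 h1)).ne this
  have hene : ∀ (e e' : E(G)) (t t' : unitInterval), 0 < (t : ℝ) → (t : ℝ) < 1 →
      G.edgePoint e t = G.edgePoint e' t' → e = e' := by
    intro e e' t t' h0 h1 hee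
    by_contra hne
    have := congrFun (congrArg Prod.snd (congrArg (G.coords fun _ => 0) hee)) e
    simp only [Graph.coords_edgePoint, Pi.single_eq_same, Pi.single_eq_of_ne hne] at this
    exact (mul_pos h0 (sub_pos.2 h1)).ne' this
  have hconn : ∀ y, IsPreconnected (c ⁻¹' {y}) := by
    intro y
    rcases G.exists_eq_vertexPoint_or_edgePoint y with ⟨v, rfl⟩ | ⟨e, t, h0, h1, rfl⟩
    · convert isPreconnected_vertexPart (C := C) hm (eV v)
      ext z
      refine ⟨fun hz => ?_, fun hz => hcv v z hz⟩
      rw [mem_preimage, mem_singleton_iff] at hz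
      rcases C.mem_vertexPart_or z with ⟨w, hw⟩ | ⟨e, x, hx, k1, k2, rfl⟩
      · obtain ⟨w, rfl⟩ := eV.surjective w
        rw [hcv w z hw] at hz
        have hwv : w = v := hinj.comp eV.injective (congrArg Prod.fst
          (congrArg (G.coords (h ∘ eV)) hz))
        rwa [← hwv]
      · rw [hce e x hx k1 k2] at hz
        exact absurd hz.symm (hvne v e _ (param_mem_Ioo k1 k2).1 (param_mem_Ioo k1 k2).2)
    · convert isPreconnected_tube_slice (C := C) hm e (hsub h0 h1).1 (hsub h0 h1).2
      ext z
      constructor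
      · intro hz
        rw [mem_preimage, mem_singleton_iff] at hz
        rcases C.mem_vertexPart_or z with ⟨w, hw⟩ | ⟨e', x, hx, k1, k2, rfl⟩
        · obtain ⟨w, rfl⟩ := eV.surjective w
          rw [hcv w z hw] at hz
          exact absurd hz (hvne w e t h0 h1)
        · rw [hce e' x hx k1 k2] at hz
          obtain rfl := hene e e' _ _ h0 h1 hz.symm
          have := Graph.coords_fst_edgePoint_injective (hinj.comp eV.injective) e
            (congrArg Prod.fst (congrArg (G.coords (h ∘ eV)) hz))
          exact ⟨x, hx, (hd ((Real.exp_pos _).trans k1)).1 (congrArg Subtype.val this), rfl⟩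
      · rintro ⟨x, hx, hxd, rfl⟩
        exact hslice e t h0 h1 x hx hxd
  let f : C.gluing.Space → ℝ := fun z => (C.coordMap h z).1
  have hfpt : ∀ j x (hx : x ∈ C.gluing.dom j), f (C.gluing.pt j x hx) = C.height h j x :=
    fun _ _ _ => rfl
  have hF : ∀ j x, x ∈ C.gluing.dom j → ContDiffAt ℝ ∞ (C.height h j) x :=
    fun j x hx => contDiffAt_height hx
  have := G.compactSpace_realization
  have : T2Space G.Realization := (Graph.isEmbedding_coords (hinj.comp eV.injective)).t2Space
  obtain ⟨φ, hφ⟩ := exists_homeomorph_reebSpace (f := f) hcont hsurj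
    (fun z => congrArg Prod.fst (hc z).symm)
    (Graph.finite_coords_fst_preimage (hinj.comp eV.injective)) hconn
  have hcrit : ∀ z ∈ criticalPoints m f, ∃ v, z ∈ C.vertexPart (eV v) := by
    intro z hz
    rcases C.mem_vertexPart_or z with ⟨w, hw⟩ | ⟨e, x, hx, k1, k2, rfl⟩
    · obtain ⟨w, rfl⟩ := eV.surjective w
      exact ⟨w, hw⟩
    · exact absurd ((SmoothGluing.pt_mem_criticalPoints_iff hF hfpt _).1 hz)
        (fderiv_height_ne_zero hinj hx k1 k2)
  refine ⟨C.gluing.Space, inferInstance, inferInstance, inferInstance,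
    ChartedSpace.secondCountable_of_sigmaCompact (EuclideanSpace ℝ (Fin m)) _, inferInstance,
    inferInstance, f, SmoothGluing.contMDiff_of_forall hF hfpt, ?_, φ, ?_⟩
  · refine (finite_range h).subset ?_
    rintro _ ⟨z, hz, rfl⟩
    obtain ⟨v, hv⟩ := hcrit z hz
    exact ⟨eV v, (congrArg Prod.fst (coordMap_of_mem_vertexPart (h := h) hv)).symm⟩
  · ext y
    constructor
    · rintro ⟨_, ⟨v, rfl⟩, rfl⟩
      obtain ⟨z, hz, hx, rfl⟩ := hcv0 v
      refine ⟨_, ?_, by rw [← hφ, hcv v _ hz]⟩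
      rw [SmoothGluing.pt_mem_criticalPoints_iff hF hfpt]
      -- The height is constant on the whole second ball, so its origin is critical.
      have hconst : C.height h (eV v, false) = fun _ => h (eV v) :=
        funext fun x => height_of_far fun h' => (Bool.false_ne_true h').elim
      rw [hconst, fderiv_fun_const]
      rfl
    · rintro ⟨z, hz, rfl⟩
      obtain ⟨v, hv⟩ := hcrit z hz
      exact ⟨_, ⟨v, rfl⟩, by rw [← hφ, hcv v z hv]⟩
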